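/- Let $n\ge 2$, $N\ge 1$, $f,r\ge 0$ be integers, let $\mathbb K=\mathbb R$ or $\mathbb C$, and let $U\subseteq\mathbb R^n$ be open. The coordinates on $U$ are $x^1,\dots,x^n$, repeated coordinate indices are summed from $1$ to $n$, and $\partial_\lambda=\partial/\partial x^\lambda$. **Lagrangian.** Let $L=L(x,u)$ be a smooth $\mathbb K$-valued function on an open set $D$ of points $(x,u)$, where $x\in\mathbb R^n$ and $u=(u_{B,\lambda_1\dots\lambda_X})$ with $1\le B\le f$, $0\le X\le N$, $1\le\lambda_j\le n$, $u_{B,\lambda_1\dots\lambda_X}\in\mathbb K$, all these variables being treated as independent. If $\mathbb K=\mathbb C$, $L$ is assumed holomorphic in $u$ (a field and its complex conjugate are counted as two fields). As usual, $L$ is written so that it depends on each $u_{B,\lambda_1\dots\lambda_X}$ only through its symmetrization: if $\bar u_{B,\lambda_1\dots\lambda_X}=\frac1{X!}\sum_{P\in S_X}u_{B,\lambda_{P(1)}\dots\lambda_{P(X)}}$, then $(x,\bar u)\in D$ and $L(x,\bar u)=L(x,u)$ for all $(x,u)\in D$. Let $\Phi=(\Phi_1,\dots,\Phi_f):U\to\mathbb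 K^f$ be smooth, with $(x,j\Phi(x))\in D$ for every $x\in U$, where $j\Phi(x)=(\partial_{\lambda_1}\cdots\partial_{\lambda_X}\Phi_B(x))_{B,\,X\le N,\,\lambda}$. Write $\dfrac{\partial L}{\partial\,\partial_{\lambda_1}\cdots\partial_{\lambda_X}\Phi_B}$ for the function $x\mapsto\dfrac{\partial L}{\partial u_{B,\lambda_1\dots\lambda_X}}(x,j\Phi(x))$, let $L$ also denote the function $x\mapsto L(x,j\Phi(x))$, and for $0\le Z\le N-1$ put $$K^{B\lambda\nu_1\dots\nu_Z}=\sum_{Y=0}^{N-1-Z}(-1)^Y\partial_{\mu_1}\cdots\partial_{\mu_Y}\frac{\partial L}{\partial\,\partial_\lambda\partial_{\mu_1}\cdots\partial_{\mu_Y}\partial_{\nu_1}\cdots\partial_{\nu_Z}\Phi_B}.$$ Suppose that $\Phi$ satisfies the Euler–Lagrange equations on $U$: $$\sum_{X=0}^{N}(-1)^X\partial_{\lambda_1}\cdots\partial_{\lambda_X}\frac{\partial L}{\partial\,\partial_{\lambda_1}\cdots\partial_{\lambda_X}\Phi_B}=0,\qquad B=1,\dots,f.$$ **Transformations.** Let $V$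 be an open neighbourhood of $0$ in $\mathbb R^r$ and let $\delta x:U\times V\to\mathbb R^n$ and $\delta\Phi:U\times V\to\mathbb K^f$ be smooth with $\delta x(x,0)=0$ and $\delta\Phi(x,0)=0$ for all $x\in U$. For $\epsilon\in V$ consider $$x\mapsto\tilde x_\epsilon(x)=x+\delta x(x,\epsilon),\qquad \tilde\Phi_\epsilon(\tilde x_\epsilon(x))=\Phi(x)+\delta\Phi(x,\epsilon).$$ Suppose the action is invariant under this infinitesimal transformation over every region with compact closure. That is, for every open $\Omega\subseteq\mathbb R^n$ whose closure is compact and contained in $U$, $$\int_{\tilde x_\epsilon(\Omega)}L\bigl(y,j\tilde\Phi_\epsilon(y)\bigr)\,d^ny-\int_\Omega L\bigl(x,j\Phi(x)\bigr)\,d^nx=o(|\epsilon|)\qquad(\epsilon\to0).$$ (For $\epsilon$ small, depending on $\Omega$, the map $\tilde x_\epsilon$ is a diffeomorphism of $\Omega$ onto the open set $\tilde x_\epsilon(\Omega)$, so $\tilde\Phi_\epsilon$ is well defined there. In particular, the condition holds if the action is exactly unchanged for all small $\epsilon$.) **Conclusion.** There are $r$ conservation laws: for each $\alpha=1,\dots,r$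 the current $$J_\alpha^\lambda=\sum_{B=1}^{f}\sum_{Z=0}^{N-1}\partial_{\nu_1}\cdots\partial_{\nu_Z}\!\left(\frac{\partial\,\delta\Phi_B}{\partial\epsilon^\alpha}\Big|_{\epsilon=0}-\frac{\partial\,\delta x^\sigma}{\partial\epsilon^\alpha}\Big|_{\epsilon=0}\,\partial_\sigma\Phi_B\right)K^{B\lambda\nu_1\dots\nu_Z}+\frac{\partial\,\delta x^\lambda}{\partial\epsilon^\alpha}\Big|_{\epsilon=0}\,L$$ is smooth on $U$ and satisfies $\partial_\lambda J_\alpha^\lambda=0$ on $U$. -/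

import Mathlib

open Set Topology MeasureTheory Asymptotics
open scoped ContDiff

noncomputable section

namespace FieldTheory

/-- Coordinate space `ℝⁿ` (with Lebesgue measure). -/
abbrev Coord (n : ℕ) : Type := Fin n → ℝ

/-- Labels `(B, X, (λ₁, …, λ_X))`, `X ≤ N`, of the variables `∂_{λ₁} ⋯ ∂_{λ_X} Φ_B`. Reordered
cross derivatives are different labels. -/
abbrev JetIndex (n f N : ℕ) : Type := Fin f × (Σ X : Fin (N + 1), (Fin X → Fin n))

/-- The space of values of all the variables `∂_{λ₁} ⋯ ∂_{λ_X} Φ_B`, `X ≤ N`. -/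
abbrev Jet (𝕜 : Type*) (n f N : ℕ) : Type _ := JetIndex n f N → 𝕜

variable {𝕜 : Type*} [RCLike 𝕜] {n f N r : ℕ}

/-- The partial derivative `∂_i F`. -/
def pderiv (i : Fin n) (F : Coord n → 𝕜) (x : Coord n) : 𝕜 :=
  fderiv ℝ F x (Pi.single i 1)

/-- The iterated partial derivative `∂_{τ₁} ⋯ ∂_{τ_k} F`. -/
def iterPderiv : {k : ℕ} → (Fin k → Fin n) → (Coord n → 𝕜) → Coord n → 𝕜
  | 0, _, F => F
  | _ + 1, τ, F => pderiv (τ 0) (iterPderiv (Fin.tail τ) F)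

/-- The derivatives of order at most `N` of the fields `Φ` at `x`. -/
def jet (N : ℕ) (Φ : Coord n → Fin f → 𝕜) (x : Coord n) : Jet 𝕜 n f N :=
  fun i => iterPderiv i.2.2 (fun y => Φ y i.1) x

/-- Replace each variable `u_{λ₁ … λ_X}` by its average over all permutations of the indices. -/
def symmetrize (u : Jet 𝕜 n f N) : Jet 𝕜 n f N :=
  fun i => ((i.2.1 : ℕ).factorial : 𝕜)⁻¹ *
    ∑ P : Equiv.Perm (Fin i.2.1), u (i.1, ⟨i.2.1, fun j => i.2.2 (P j)⟩)

/-- `L` is a Lagrangian on the open set `D` of points `(x, u)`: it is smooth, it is differentiable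
over `𝕜` in the field variables (automatic for `𝕜 = ℝ`; for `𝕜 = ℂ`, a field and its complex
conjugate count as two fields), and it is written in the standard form, in which it depends on the
variables `∂_{λ₁} ⋯ ∂_{λ_X} Φ_B` only through their symmetrizations. -/
structure IsLagrangian (D : Set (Coord n × Jet 𝕜 n f N)) (L : Coord n × Jet 𝕜 n f N → 𝕜) :
    Prop where
  isOpen : IsOpen D
  contDiffOn : ContDiffOn ℝ ∞ L D
  differentiableAt : ∀ p ∈ D, DifferentiableAt 𝕜 (fun u => L (p.1, u)) p.2
  symmetrize_mem : ∀ p ∈ D, (p.1, symmetrize p.2) ∈ D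
  map_symmetrize : ∀ p ∈ D, L (p.1, symmetrize p.2) = L p

/-- `∂L / ∂(∂_{τ₁} ⋯ ∂_{τ_k} Φ_B)`, all the variables of `L` being treated as independent. -/
def lagrangianDeriv (L : Coord n × Jet 𝕜 n f N → 𝕜) (B : Fin f) {k : ℕ} (hk : k ≤ N)
    (τ : Fin k → Fin n) (p : Coord n × Jet 𝕜 n f N) : 𝕜 :=
  fderiv 𝕜 (fun u => L (p.1, u)) p.2 (Pi.single (B, ⟨⟨k, Nat.lt_succ_of_le hk⟩, τ⟩) 1)

/-- The left-hand side of the Euler–Lagrange equation,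
`∑_{X ≤ N} (-1)^X ∂_{λ₁} ⋯ ∂_{λ_X} (∂L / ∂(∂_{λ₁} ⋯ ∂_{λ_X} Φ_B))`. -/
def eulerLagrange (L : Coord n × Jet 𝕜 n f N → 𝕜) (Φ : Coord n → Fin f → 𝕜) (B : Fin f)
    (x : Coord n) : 𝕜 :=
  ∑ X : Fin (N + 1), (-1) ^ (X : ℕ) * ∑ τ : Fin X → Fin n,
    iterPderiv τ (fun y => lagrangianDeriv L B (Nat.le_of_lt_succ X.2) τ (y, jet N Φ y)) x

/-- The momenta `K^{B l ν₁ … ν_Z} = ∑_{Y ≤ N - 1 - Z} (-1)^Y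
∂_{μ₁} ⋯ ∂_{μ_Y} (∂L / ∂(∂_l ∂_{μ₁} ⋯ ∂_{μ_Y} ∂_{ν₁} ⋯ ∂_{ν_Z} Φ_B))`, for `Z ≤ N - 1`. -/
def momentum (L : Coord n × Jet 𝕜 n f N → 𝕜) (Φ : Coord n → Fin f → 𝕜) (B : Fin f) (l : Fin n)
    (Z : Fin N) (ν : Fin Z → Fin n) (x : Coord n) : 𝕜 :=
  ∑ Y : Fin (N - Z), (-1) ^ (Y : ℕ) * ∑ μ : Fin Y → Fin n,
    iterPderiv μ (fun y => lagrangianDeriv L B (k := Y + Z + 1) (by omega)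
      (Fin.cons l (Fin.append μ ν)) (y, jet N Φ y)) x

/-- The action of the fields `Φ` over the region `Ω`. -/
def action (L : Coord n × Jet 𝕜 n f N → 𝕜) (Φ : Coord n → Fin f → 𝕜) (Ω : Set (Coord n)) : 𝕜 :=
  ∫ x in Ω, L (x, jet N Φ x)

/-- The transformation of coordinates `x ↦ x + δx(x, ε)`. -/
def coordMap (δx : Coord n → (Fin r → ℝ) → Coord n) (ε : Fin r → ℝ) (x : Coord n) : Coord n :=
  x + δx x ε

/-- The transformed fields over the transformed region `coordMap δx ε '' Ω`, determined by
`Φ̃(x + δx(x, ε)) = Φ(x) + δΦ(x, ε)` for `x ∈ Ω`. If the closure of `Ω` is compact, `coordMap δx ε`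
is injective on `Ω` for all small `ε`. -/
def transformedField (Φ : Coord n → Fin f → 𝕜) (δx : Coord n → (Fin r → ℝ) → Coord n)
    (δΦ : Coord n → (Fin r → ℝ) → Fin f → 𝕜) (Ω : Set (Coord n)) (ε : Fin r → ℝ)
    (y : Coord n) : Fin f → 𝕜 :=
  Φ (Function.invFunOn (coordMap δx ε) Ω y) + δΦ (Function.invFunOn (coordMap δx ε) Ω y) ε

/-- The action over every region `Ω` with compact closure in `U` is unchanged, to first order in
the parameters, by the infinitesimal transformation `(δx, δΦ)`. -/
def ActionInvariant (U : Set (Coord n)) (L : Coord n × Jet 𝕜 n f N → 𝕜)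
    (Φ : Coord n → Fin f → 𝕜) (δx : Coord n → (Fin r → ℝ) → Coord n)
    (δΦ : Coord n → (Fin r → ℝ) → Fin f → 𝕜) : Prop :=
  ∀ Ω : Set (Coord n), IsOpen Ω → IsCompact (closure Ω) → closure Ω ⊆ U →
    (fun ε : Fin r → ℝ =>
      action L (transformedField Φ δx δΦ Ω ε) (coordMap δx ε '' Ω) - action L Φ Ω)
        =o[𝓝 0] (fun ε : Fin r → ℝ => ε)

/-- `∂(δx^s)/∂ε^α` at `ε = 0`. -/
def coordGenerator (δx : Coord n → (Fin r → ℝ) → Coord n) (α : Fin r) (s : Fin n)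
    (x : Coord n) : ℝ :=
  fderiv ℝ (fun ε => δx x ε s) 0 (Pi.single α 1)

/-- `∂(δΦ_B)/∂ε^α` at `ε = 0`. -/
def fieldGenerator (δΦ : Coord n → (Fin r → ℝ) → Fin f → 𝕜) (α : Fin r) (B : Fin f)
    (x : Coord n) : 𝕜 :=
  fderiv ℝ (fun ε => δΦ x ε B) 0 (Pi.single α 1)

/-- The component `l` of the current
`∑_B ∑_{Z < N} ∂_{ν₁} ⋯ ∂_{ν_Z} (∂δΦ_B/∂ε^α - (∂δx^s/∂ε^α) ∂_s Φ_B) K^{B l ν₁ … ν_Z}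
  + (∂δx^l/∂ε^α) L`. -/
def noetherCurrent (L : Coord n × Jet 𝕜 n f N → 𝕜) (Φ : Coord n → Fin f → 𝕜)
    (δx : Coord n → (Fin r → ℝ) → Coord n) (δΦ : Coord n → (Fin r → ℝ) → Fin f → 𝕜)
    (α : Fin r) (l : Fin n) (x : Coord n) : 𝕜 :=
  (∑ B : Fin f, ∑ Z : Fin N, ∑ ν : Fin Z → Fin n,
    iterPderiv ν (fun y => fieldGenerator δΦ α B y -
      ∑ s : Fin n, (coordGenerator δx α s y : 𝕜) * pderiv s (fun z => Φ z B) y) x *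
        momentum L Φ B l Z ν x)
    + (coordGenerator δx α l x : 𝕜) * L (x, jet N Φ x)

end FieldTheory

end

/-! Write ξ^l for the generator of δx along ε^α, and η_B for the field generator minus ξ^s ∂_s Φ_B,
the variation of the fields at a fixed point. The theorem combines two expressions for L'(jη) +
∂_l(ξ^l L), where L'(jη) is the derivative of L at jΦ in the direction of the jet of η.

The first is algebraic. Since L depends on symmetrized variables only, its derivatives at a jet are
symmetric in their indices, so the Leibniz rule for ∂_l of a term of the current gives two
contractions of the same kind: one with another derivative on ∂L, one with another on η. With the
signs of K these telescope along each total order of differentiation (`sum_triangle_alternating`,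
`divergence_sum_pairingCurrent`). What remains is L'(jη) minus the Euler–Lagrange expressions times
η. On a solution the divergence of the current is therefore L'(jη) + ∂_l(ξ^l L)
(`divergence_noetherCurrent`).

The second is analytic. Restrict the parameters to the line t ↦ t e_α and treat t as an extra
coordinate: (x, t) ↦ (x + δx, t) is a local diffeomorphism near (x, 0), so the transformed fields
are jointly smooth in (y, t). A change of variables pulls the transformed action over a small ball
back to that ball (`action_transformedField`). The t-derivative at 0 of the new integrand is exactly
L'(jη) + ∂_l(ξ^l L): the Jacobian contributes (∂_l ξ^l)L and the displacement of the point
contributes ξ^l ∂_l L (`exists_isOpen_contDiffOn_pulledBackDensity`). Invariance makes its integral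
vanish over all small balls, hence it vanishes at the centre
(`variation_eq_zero_of_actionInvariant`). -/

noncomputable section

namespace FieldTheory

/-! ### Iterated directional derivatives and their symmetry -/

section DirectionalDerivatives

variable {E G : Type*} [NormedAddCommGroup E] [NormedSpace ℝ E] [NormedAddCommGroup G]
  [NormedSpace ℝ G]

/-- The derivative of `F` in the direction `v`. -/
def dirDeriv (v : E) (F : E → G) (x : E) : G := fderiv ℝ F x v

theorem ContDiffOn.differentiableAt_of_isOpen {U : Set E} {F : E → G} (hF : ContDiffOn ℝ ∞ F U)
    (hU : IsOpen U) {x : E} (hx : x ∈ U) : DifferentiableAt ℝ F x :=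
  (hF.contDiffAt (hU.mem_nhds hx)).differentiableAt (by simp)

theorem contDiffOn_dirDeriv {U : Set E} {F : E → G} (hU : IsOpen U) (hF : ContDiffOn ℝ ∞ F U)
    (v : E) : ContDiffOn ℝ ∞ (dirDeriv v F) U :=
  (hF.fderiv_of_isOpen hU (by simp)).clm_apply contDiffOn_const

theorem dirDeriv_congr {U : Set E} {F F' : E → G} (hU : IsOpen U) (h : EqOn F F' U) (v : E) :
    EqOn (dirDeriv v F) (dirDeriv v F') U := fun x hx => by
  rw [dirDeriv, dirDeriv, (h.eventuallyEq_of_mem (hU.mem_nhds hx)).fderiv_eq]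

theorem dirDeriv_comm {U : Set E} {F : E → G} (hU : IsOpen U) (hF : ContDiffOn ℝ ∞ F U)
    (v w : E) : EqOn (dirDeriv v (dirDeriv w F)) (dirDeriv w (dirDeriv v F)) U := fun x hx => by
  have hd : DifferentiableAt ℝ (fderiv ℝ F) x :=
    ContDiffOn.differentiableAt_of_isOpen (hF.fderiv_of_isOpen hU (by simp)) hU hx
  have key : ∀ a b : E, dirDeriv a (dirDeriv b F) x = fderiv ℝ (fderiv ℝ F) x a b := fun a b => by
    have : dirDeriv b F = fun y => fderiv ℝ F y b := rfl
    rw [dirDeriv, this, fderiv_clm_apply hd (differentiableAt_const _)]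
    simp
  rw [key, key]
  exact ((hF.contDiffAt (hU.mem_nhds hx)).isSymmSndFDerivAt
    (by simpa using WithTop.coe_le_coe.2 (le_top : (2 : ℕ∞) ≤ ⊤))) v w

/-- The iterated derivative of `F` in the directions listed in `w`. -/
def listDeriv (w : List E) (F : E → G) : E → G := w.foldr dirDeriv F

@[simp] theorem listDeriv_nil (F : E → G) : listDeriv [] F = F := rfl

@[simp] theorem listDeriv_cons (v : E) (w : List E) (F : E → G) :
    listDeriv (v :: w) F = dirDeriv v (listDeriv w F) := rfl

theorem contDiffOn_listDeriv {U : Set E} {F : E → G} (hU : IsOpen U) (hF : ContDiffOn ℝ ∞ F U)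
    (w : List E) : ContDiffOn ℝ ∞ (listDeriv w F) U := by
  induction w with
  | nil => exact hF
  | cons v w ih => exact contDiffOn_dirDeriv hU ih v

theorem listDeriv_congr {U : Set E} {F F' : E → G} (hU : IsOpen U) (h : EqOn F F' U)
    (w : List E) : EqOn (listDeriv w F) (listDeriv w F') U := by
  induction w with
  | nil => exact h
  | cons v w ih => exact dirDeriv_congr hU ih v

theorem listDeriv_perm {U : Set E} {F : E → G} (hU : IsOpen U) (hF : ContDiffOn ℝ ∞ F U)
    {w w' : List E} (h : w.Perm w') : EqOn (listDeriv w F) (listDeriv w' F) U := by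
  induction h with
  | nil => exact fun _ _ => rfl
  | cons v _ ih => exact dirDeriv_congr hU ih v
  | swap v v' w => exact dirDeriv_comm hU (contDiffOn_listDeriv hU hF w) v' v
  | trans _ _ ih ih' => exact ih.trans ih'

/-- Used to move a time derivative past the space derivatives that make up a jet. -/
theorem dirDeriv_listDeriv {U : Set E} {F : E → G} (hU : IsOpen U) (hF : ContDiffOn ℝ ∞ F U)
    (v : E) (w : List E) :
    EqOn (dirDeriv v (listDeriv w F)) (listDeriv w (dirDeriv v F)) U := by
  induction w with
  | nil => exact fun _ _ => rfl
  | cons a w ih =>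
    exact (dirDeriv_comm hU (contDiffOn_listDeriv hU hF w) v a).trans (dirDeriv_congr hU ih a)

theorem dirDeriv_sum {ι : Type*} {s : Finset ι} {F : ι → E → G} {x : E}
    (hF : ∀ i ∈ s, DifferentiableAt ℝ (F i) x) (v : E) :
    dirDeriv v (fun y => ∑ i ∈ s, F i y) x = ∑ i ∈ s, dirDeriv v (F i) x := by
  simp only [dirDeriv]
  rw [fderiv_fun_sum hF]
  simp

theorem dirDeriv_mul {𝕜 : Type*} [RCLike 𝕜] {F F' : E → 𝕜} {x : E}
    (hF : DifferentiableAt ℝ F x) (hF' : DifferentiableAt ℝ F' x) (v : E) :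
    dirDeriv v (fun y => F y * F' y) x = dirDeriv v F x * F' x + F x * dirDeriv v F' x := by
  simp only [dirDeriv]
  rw [fderiv_fun_mul hF hF']
  simp only [add_apply, smul_apply, smul_eq_mul]
  ring

end DirectionalDerivatives

/-! ### Iterated partial derivatives in coordinates -/

section PartialDerivatives

variable {𝕜 : Type*} [RCLike 𝕜] {n f N r : ℕ}

/-- The list of coordinate directions with the indices `w`. -/
def coordDirs (w : List (Fin n)) : List (Coord n) := w.map fun i => Pi.single i 1

theorem pderiv_eq_dirDeriv (i : Fin n) (F : Coord n → 𝕜) :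
    pderiv i F = dirDeriv (Pi.single i 1) F := rfl

theorem iterPderiv_eq_listDeriv {k : ℕ} (τ : Fin k → Fin n) (F : Coord n → 𝕜) :
    iterPderiv τ F = listDeriv (coordDirs (List.ofFn τ)) F := by
  induction k with
  | zero => simp [iterPderiv, coordDirs]
  | succ k ih =>
    rw [iterPderiv, ih, List.ofFn_succ]
    rfl

theorem contDiffOn_iterPderiv {U : Set (Coord n)} {F : Coord n → 𝕜} (hU : IsOpen U)
    (hF : ContDiffOn ℝ ∞ F U) {k : ℕ} (τ : Fin k → Fin n) :
    ContDiffOn ℝ ∞ (iterPderiv τ F) U := by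
  rw [iterPderiv_eq_listDeriv]
  exact contDiffOn_listDeriv hU hF _

theorem iterPderiv_perm {U : Set (Coord n)} {F : Coord n → 𝕜} (hU : IsOpen U)
    (hF : ContDiffOn ℝ ∞ F U) {k : ℕ} (τ : Fin k → Fin n) (P : Equiv.Perm (Fin k)) :
    EqOn (iterPderiv (fun j => τ (P j)) F) (iterPderiv τ F) U := by
  rw [iterPderiv_eq_listDeriv, iterPderiv_eq_listDeriv]
  exact listDeriv_perm hU hF ((P.ofFn_comp_perm τ).map _)

end PartialDerivatives

/-! ### Telescoping of the divergence: integration by parts in local form -/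

section Divergence

variable {𝕜 : Type*} [RCLike 𝕜] {n f N r : ℕ}

/-- On each diagonal Y + Z = m the sum telescopes, leaving its two ends of total order m + 1. The
order-zero terms A 0 0 on the right cancel each other. -/
theorem sum_triangle_alternating {R : Type*} [CommRing R] (A : ℕ → ℕ → R) (N : ℕ) :
    ∑ Z ∈ Finset.range N, ∑ Y ∈ Finset.range (N - Z), (-1) ^ Y * (A (Y + 1) Z + A Y (Z + 1)) =
      ∑ Z ∈ Finset.range (N + 1), A 0 Z - ∑ Y ∈ Finset.range (N + 1), (-1) ^ Y * A Y 0 := by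
  rw [← Finset.sum_range_diag_flip N fun Z Y => (-1) ^ Y * (A (Y + 1) Z + A Y (Z + 1)),
    Finset.sum_range_succ', Finset.sum_range_succ' (fun Y => (-1) ^ Y * A Y 0)]
  simp only [pow_zero, one_mul, add_sub_add_right_eq_sub, ← Finset.sum_sub_distrib]
  refine Finset.sum_congr rfl fun m _ => ?_
  -- The telescoping sequence in k = Z: consecutive signs are opposite, so each summand is a
  -- difference of neighbours.
  have h := Finset.sum_range_sub (fun k => (-1) ^ (m + 1 - k) * A (m + 1 - k) k) (m + 1)
  simp only [tsub_self, pow_zero, one_mul, tsub_zero] at h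
  rw [← h]
  refine Finset.sum_congr rfl fun k hk => ?_
  have hk' : k ≤ m := Nat.lt_succ_iff.1 (Finset.mem_range.1 hk)
  rw [show m + 1 - (k + 1) = m - k by omega, show m + 1 - k = m - k + 1 by omega]
  ring

theorem sum_fin_succ_fun {α M : Type*} [Fintype α] [AddCommMonoid M] {k : ℕ}
    (g : (Fin (k + 1) → α) → M) :
    ∑ τ, g τ = ∑ l : α, ∑ μ : Fin k → α, g (Fin.cons l μ) := by
  rw [← Fintype.sum_prod_type' (fun l (μ : Fin k → α) => g (Fin.cons l μ))]
  exact ((Fin.consEquiv fun _ => α).sum_comp g).symm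

theorem iterPderiv_cons {k : ℕ} (l : Fin n) (μ : Fin k → Fin n) (F : Coord n → 𝕜) :
    iterPderiv (Fin.cons l μ : Fin (k + 1) → Fin n) F = pderiv l (iterPderiv μ F) := by
  rw [iterPderiv, Fin.cons_zero, Fin.tail_cons]

theorem iterPderiv_congr {U : Set (Coord n)} {F F' : Coord n → 𝕜} (hU : IsOpen U)
    (h : EqOn F F' U) {k : ℕ} (τ : Fin k → Fin n) : EqOn (iterPderiv τ F) (iterPderiv τ F') U := by
  rw [iterPderiv_eq_listDeriv, iterPderiv_eq_listDeriv]
  exact listDeriv_congr hU h _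

/-- The contraction `∑ ∂_μ P^{μν} ∂_ν η` over `Y` indices `μ` and `Z` indices `ν`. -/
def pairing (P : List (Fin n) → Coord n → 𝕜) (η : Coord n → 𝕜) (Y Z : ℕ) (x : Coord n) : 𝕜 :=
  ∑ μ : Fin Y → Fin n, ∑ ν : Fin Z → Fin n,
    iterPderiv μ (P (List.ofFn μ ++ List.ofFn ν)) x * iterPderiv ν η x

/-- The component `l` of the current `∑ ∂_μ P^{lμν} ∂_ν η` with `Y` indices `μ` and `Z`
indices `ν`. -/
def pairingCurrent (P : List (Fin n) → Coord n → 𝕜) (η : Coord n → 𝕜) (Y Z : ℕ) (l : Fin n)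
    (x : Coord n) : 𝕜 :=
  ∑ μ : Fin Y → Fin n, ∑ ν : Fin Z → Fin n,
    iterPderiv ν η x * iterPderiv μ (P (l :: (List.ofFn μ ++ List.ofFn ν))) x

theorem contDiffOn_pairingCurrent {U : Set (Coord n)} (hU : IsOpen U)
    {P : List (Fin n) → Coord n → 𝕜} (hP : ∀ w, ContDiffOn ℝ ∞ (P w) U) {η : Coord n → 𝕜}
    (hη : ContDiffOn ℝ ∞ η U) (Y Z : ℕ) (l : Fin n) :
    ContDiffOn ℝ ∞ (pairingCurrent P η Y Z l) U :=
  ContDiffOn.sum fun μ _ => ContDiffOn.sum fun ν _ =>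
    (contDiffOn_iterPderiv hU hη ν).mul (contDiffOn_iterPderiv hU (hP _) μ)

/-- Leibniz rule: ∂_l falls either on ∂_μ P, extending μ, or on ∂_ν η, extending ν. The second case
needs P symmetric, so that the leading index l can be moved next to ν. -/
theorem divergence_pairingCurrent {U : Set (Coord n)} (hU : IsOpen U)
    {P : List (Fin n) → Coord n → 𝕜} (hP : ∀ w, ContDiffOn ℝ ∞ (P w) U)
    (hperm : ∀ w w' : List (Fin n), w.Perm w' → EqOn (P w) (P w') U) {η : Coord n → 𝕜}
    (hη : ContDiffOn ℝ ∞ η U) (Y Z : ℕ) {x : Coord n} (hx : x ∈ U) :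
    ∑ l, pderiv l (pairingCurrent P η Y Z l) x =
      pairing P η (Y + 1) Z x + pairing P η Y (Z + 1) x := by
  have d1 : ∀ {k : ℕ} (ν : Fin k → Fin n), DifferentiableAt ℝ (iterPderiv ν η) x := fun ν =>
    ContDiffOn.differentiableAt_of_isOpen (contDiffOn_iterPderiv hU hη ν) hU hx
  have d2 : ∀ {k : ℕ} (μ : Fin k → Fin n) w, DifferentiableAt ℝ (iterPderiv μ (P w)) x :=
    fun μ w => ContDiffOn.differentiableAt_of_isOpen (contDiffOn_iterPderiv hU (hP w) μ) hU hx
  have hl : ∀ l, pderiv l (pairingCurrent P η Y Z l) x =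
      ∑ μ : Fin Y → Fin n, ∑ ν : Fin Z → Fin n,
        (iterPderiv (Fin.cons l μ : Fin (Y + 1) → Fin n)
          (P (l :: (List.ofFn μ ++ List.ofFn ν))) x * iterPderiv ν η x +
        iterPderiv μ (P (List.ofFn μ ++ l :: List.ofFn ν)) x *
          iterPderiv (Fin.cons l ν : Fin (Z + 1) → Fin n) η x) := by
    intro l
    have : pairingCurrent P η Y Z l = fun x => ∑ μ : Fin Y → Fin n, ∑ ν : Fin Z → Fin n,
      iterPderiv ν η x * iterPderiv μ (P (l :: (List.ofFn μ ++ List.ofFn ν))) x := rfl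
    rw [pderiv_eq_dirDeriv, this, dirDeriv_sum fun μ _ => DifferentiableAt.fun_sum fun ν _ =>
      (d1 ν).fun_mul (d2 μ _)]
    refine Finset.sum_congr rfl fun μ _ => ?_
    rw [dirDeriv_sum fun ν _ => (d1 ν).fun_mul (d2 μ _)]
    refine Finset.sum_congr rfl fun ν _ => ?_
    rw [dirDeriv_mul (d1 ν) (d2 μ _), iterPderiv_cons, iterPderiv_cons, pderiv_eq_dirDeriv,
      pderiv_eq_dirDeriv, iterPderiv_congr hU (hperm _ _ List.perm_middle) μ hx]
    ring
  simp only [hl, pairing, Finset.sum_add_distrib]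
  congr 1
  · rw [sum_fin_succ_fun]
    simp
  · rw [Finset.sum_comm]
    refine Finset.sum_congr rfl fun μ _ => ?_
    rw [sum_fin_succ_fun]
    simp

/-- All derivatives are shifted from η to P up to a divergence: the terms with every derivative on η
and those with every derivative on P survive the telescoping. -/
theorem divergence_sum_pairingCurrent {U : Set (Coord n)} (hU : IsOpen U)
    {P : List (Fin n) → Coord n → 𝕜} (hP : ∀ w, ContDiffOn ℝ ∞ (P w) U)
    (hperm : ∀ w w' : List (Fin n), w.Perm w' → EqOn (P w) (P w') U) {η : Coord n → 𝕜}
    (hη : ContDiffOn ℝ ∞ η U) (N : ℕ) {x : Coord n} (hx : x ∈ U) :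
    ∑ l, pderiv l (fun y => ∑ Z ∈ Finset.range N, ∑ Y ∈ Finset.range (N - Z),
        (-1) ^ Y * pairingCurrent P η Y Z l y) x =
      ∑ Z ∈ Finset.range (N + 1), pairing P η 0 Z x -
        ∑ Y ∈ Finset.range (N + 1), (-1) ^ Y * pairing P η Y 0 x := by
  have d : ∀ Y Z l, DifferentiableAt ℝ (pairingCurrent P η Y Z l) x := fun Y Z l =>
    ContDiffOn.differentiableAt_of_isOpen (contDiffOn_pairingCurrent hU hP hη Y Z l) hU hx
  rw [← sum_triangle_alternating fun Y Z => pairing P η Y Z x]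
  simp only [← divergence_pairingCurrent hU hP hperm hη _ _ hx, Finset.mul_sum]
  rw [Finset.sum_congr rfl fun Z _ => Finset.sum_comm, Finset.sum_comm]
  refine Finset.sum_congr rfl fun l _ => ?_
  rw [pderiv_eq_dirDeriv, dirDeriv_sum fun Z _ => DifferentiableAt.fun_sum fun Y _ =>
      (d Y Z l).const_mul _]
  refine Finset.sum_congr rfl fun Z _ => ?_
  rw [dirDeriv_sum fun Y _ => (d Y Z l).const_mul _]
  refine Finset.sum_congr rfl fun Y _ => ?_
  rw [dirDeriv_mul (differentiableAt_const _) (d Y Z l), pderiv_eq_dirDeriv]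
  simp [dirDeriv]

end Divergence

/-! ### Derivatives of the Lagrangian and their symmetry in the indices -/

section LagrangianDerivatives

variable {𝕜 : Type*} [RCLike 𝕜] {n f N r : ℕ}

theorem contDiffOn_component {U : Set (Coord n)} {Φ : Coord n → Fin f → 𝕜}
    (hΦ : ContDiffOn ℝ ∞ Φ U) (B : Fin f) : ContDiffOn ℝ ∞ (fun y => Φ y B) U :=
  contDiffOn_pi.1 hΦ B

theorem contDiffOn_jet {U : Set (Coord n)} (hU : IsOpen U) {Φ : Coord n → Fin f → 𝕜}
    (hΦ : ContDiffOn ℝ ∞ Φ U) : ContDiffOn ℝ ∞ (jet N Φ) U :=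
  contDiffOn_pi.2 fun i => contDiffOn_iterPderiv hU (contDiffOn_component hΦ i.1) i.2.2

theorem symmetrize_jet {U : Set (Coord n)} (hU : IsOpen U) {Φ : Coord n → Fin f → 𝕜}
    (hΦ : ContDiffOn ℝ ∞ Φ U) {x : Coord n} (hx : x ∈ U) :
    symmetrize (jet N Φ x) = jet N Φ x := by
  funext i
  have h : ∀ P : Equiv.Perm (Fin i.2.1),
      jet N Φ x (i.1, ⟨i.2.1, fun j => i.2.2 (P j)⟩) = jet N Φ x i := fun P =>
    iterPderiv_perm hU (contDiffOn_component hΦ i.1) i.2.2 P hx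
  simp only [symmetrize, h, Finset.sum_const, Finset.card_univ, Fintype.card_perm,
    Fintype.card_fin, nsmul_eq_mul]
  rw [inv_mul_cancel_left₀ (Nat.cast_ne_zero.2 (Nat.factorial_ne_zero _))]

/-- Symmetrization of the jet variables as a linear map. -/
def symmetrizeLM (𝕜 : Type*) [RCLike 𝕜] (n f N : ℕ) : Jet 𝕜 n f N →ₗ[𝕜] Jet 𝕜 n f N where
  toFun := symmetrize
  map_add' u v := by
    funext i
    simp [symmetrize, Finset.sum_add_distrib, mul_add]
  map_smul' c u := by
    funext i
    simp only [symmetrize, Pi.smul_apply, smul_eq_mul, ← Finset.mul_sum, RingHom.id_apply]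
    ring

theorem symmetrize_single_comp (B : Fin f) {k : ℕ} (hk : k < N + 1) (τ : Fin k → Fin n)
    (σ : Equiv.Perm (Fin k)) :
    symmetrize (Pi.single (B, ⟨⟨k, hk⟩, τ ∘ σ⟩) 1 : Jet 𝕜 n f N) =
      symmetrize (Pi.single (B, ⟨⟨k, hk⟩, τ⟩) 1) := by
  funext i
  obtain ⟨B', ⟨⟨k', hk'⟩, τ'⟩⟩ := i
  simp only [symmetrize]
  congr 1
  by_cases h : k' = k
  · subst h
    -- τ' ∘ P = τ ∘ σ exactly when τ' ∘ (P σ⁻¹) = τ.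
    refine Fintype.sum_equiv (Equiv.mulRight σ⁻¹) _ _ fun P => ?_
    simp only [Pi.single_apply]
    refine if_congr ?_ rfl rfl
    simp only [Prod.mk.injEq, Sigma.mk.injEq, heq_eq_eq, true_and]
    refine and_congr_right fun _ => ⟨fun h => ?_, fun h => ?_⟩
    · funext j
      have := congrFun h (σ⁻¹ j)
      simpa using this
    · funext j
      have := congrFun h (σ j)
      simpa using this
  · refine Finset.sum_congr rfl fun P _ => ?_
    rw [Pi.single_apply, Pi.single_apply, if_neg, if_neg] <;> simp [h]

namespace IsLagrangian

variable {D : Set (Coord n × Jet 𝕜 n f N)} {L : Coord n × Jet 𝕜 n f N → 𝕜}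

/-- Bridges the two notions of derivative: smoothness of `L` is over ℝ and joint in (x, u), while
its field derivatives are taken over 𝕜 at fixed x. -/
theorem fderiv_jet_apply (hL : IsLagrangian D L) {p : Coord n × Jet 𝕜 n f N} (hp : p ∈ D)
    (v : Jet 𝕜 n f N) :
    fderiv 𝕜 (fun u => L (p.1, u)) p.2 v = fderiv ℝ L p (0, v) := by
  have h1 := ((hL.differentiableAt p hp).hasFDerivAt.restrictScalars ℝ)
  have h2 : HasFDerivAt (fun u => L (p.1, u))
      ((fderiv ℝ L p).comp (ContinuousLinearMap.inr ℝ (Coord n) (Jet 𝕜 n f N))) p.2 :=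
    HasFDerivAt.comp p.2
      (ContDiffOn.differentiableAt_of_isOpen hL.contDiffOn hL.isOpen hp).hasFDerivAt
      (hasFDerivAt_prodMk_right p.1 p.2)
  exact DFunLike.congr_fun (h1.unique h2) v

theorem fderiv_apply_eq_sum (hL : IsLagrangian D L) {p : Coord n × Jet 𝕜 n f N} (hp : p ∈ D)
    (v : Jet 𝕜 n f N) :
    fderiv ℝ L p (0, v) = ∑ B : Fin f, ∑ X : Fin (N + 1), ∑ τ : Fin X → Fin n,
      lagrangianDeriv L B (Nat.le_of_lt_succ X.2) τ p * v (B, ⟨X, τ⟩) := by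
  rw [← hL.fderiv_jet_apply hp]
  conv_lhs => rw [← Finset.univ_sum_single v, map_sum, Fintype.sum_prod_type]
  refine Finset.sum_congr rfl fun B _ => ?_
  rw [Fintype.sum_sigma]
  refine Finset.sum_congr rfl fun X _ => Finset.sum_congr rfl fun τ _ => ?_
  rw [lagrangianDeriv, ← mul_one (v (B, ⟨X, τ⟩)), ← smul_eq_mul, Pi.single_smul', map_smul,
    smul_eq_mul, smul_eq_mul, mul_one, mul_comm]

/-- Differentiate L ∘ symmetrize = L, which holds near `p`. Symmetrization is linear and fixes
`p.2`, so both sides involve the derivative of L at the same point. -/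
theorem fderiv_symmetrize (hL : IsLagrangian D L) {p : Coord n × Jet 𝕜 n f N} (hp : p ∈ D)
    (hs : symmetrize p.2 = p.2) (v : Jet 𝕜 n f N) :
    fderiv 𝕜 (fun u => L (p.1, u)) p.2 (symmetrize v) =
      fderiv 𝕜 (fun u => L (p.1, u)) p.2 v := by
  have hd := (hL.differentiableAt p hp).hasFDerivAt
  have hS : HasFDerivAt (symmetrize : Jet 𝕜 n f N → Jet 𝕜 n f N)
    (symmetrizeLM 𝕜 n f N).toContinuousLinearMap p.2 :=
    (symmetrizeLM 𝕜 n f N).toContinuousLinearMap.hasFDerivAt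
  have hc := HasFDerivAt.comp p.2 (hs.symm ▸ hd : HasFDerivAt (fun u => L (p.1, u))
    (fderiv 𝕜 (fun u => L (p.1, u)) p.2) (symmetrize p.2)) hS
  have hev : (fun u => L (p.1, u)) ∘ symmetrize =ᶠ[𝓝 p.2] fun u => L (p.1, u) := by
    have : ∀ᶠ u in 𝓝 p.2, (p.1, u) ∈ D :=
      (Continuous.prodMk_right p.1).continuousAt.eventually (hL.isOpen.mem_nhds hp)
    filter_upwards [this] with u hu using hL.map_symmetrize _ hu
  exact DFunLike.congr_fun ((hc.congr_of_eventuallyEq hev.symm).unique hd) v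

theorem lagrangianDeriv_comp_perm (hL : IsLagrangian D L) {p : Coord n × Jet 𝕜 n f N}
    (hp : p ∈ D) (hs : symmetrize p.2 = p.2) (B : Fin f) {k : ℕ} (hk : k ≤ N)
    (τ : Fin k → Fin n) (σ : Equiv.Perm (Fin k)) :
    lagrangianDeriv L B hk (τ ∘ σ) p = lagrangianDeriv L B hk τ p := by
  rw [lagrangianDeriv, lagrangianDeriv, ← hL.fderiv_symmetrize hp hs, symmetrize_single_comp,
    hL.fderiv_symmetrize hp hs]

theorem contDiffOn_lagrangianDeriv (hL : IsLagrangian D L) (B : Fin f) {k : ℕ} (hk : k ≤ N)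
    (τ : Fin k → Fin n) : ContDiffOn ℝ ∞ (lagrangianDeriv L B hk τ) D :=
  (contDiffOn_dirDeriv hL.isOpen hL.contDiffOn _).congr fun _ hp => hL.fderiv_jet_apply hp _

end IsLagrangian

/-- The derivative of `L` with respect to the variable of `Φ_B` labelled by the word `w`, along the
fields `Φ`; it is zero if `w` has length more than `N`. -/
def wordDeriv (L : Coord n × Jet 𝕜 n f N → 𝕜) (Φ : Coord n → Fin f → 𝕜) (B : Fin f)
    (w : List (Fin n)) (y : Coord n) : 𝕜 :=
  if h : w.length ≤ N then lagrangianDeriv L B h w.get (y, jet N Φ y) else 0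

/-- Lists replace index tuples so that concatenation and permutation do not change types; this lemma
translates back. -/
theorem wordDeriv_ofFn (L : Coord n × Jet 𝕜 n f N → 𝕜) (Φ : Coord n → Fin f → 𝕜) (B : Fin f)
    {k : ℕ} (hk : k ≤ N) (τ : Fin k → Fin n) :
    wordDeriv L Φ B (List.ofFn τ) = fun y => lagrangianDeriv L B hk τ (y, jet N Φ y) := by
  -- Equality of pairs (length, tuple) avoids casting along an equality of lengths.
  have key : ∀ s t : Σ k, Fin k → Fin n, s = t → ∀ (hs : s.1 ≤ N) (ht : t.1 ≤ N) p,
      lagrangianDeriv L B hs s.2 p = lagrangianDeriv L B ht t.2 p := by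
    rintro s _ rfl hs ht p
    rfl
  funext y
  rw [wordDeriv, dif_pos (by simpa using hk)]
  exact key ⟨_, (List.ofFn τ).get⟩ ⟨k, τ⟩ (List.equivSigmaTuple.right_inv ⟨k, τ⟩) _ _ _

/-- Both tuples have the same sorted form, so one sorting permutation followed by the inverse of the
other relates them. -/
theorem exists_perm_of_ofFn_perm {k : ℕ} {τ τ' : Fin k → Fin n}
    (h : (List.ofFn τ).Perm (List.ofFn τ')) : ∃ σ : Equiv.Perm (Fin k), τ' = τ ∘ σ := by
  have hs : τ ∘ Tuple.sort τ = τ' ∘ Tuple.sort τ' := by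
    refine List.ofFn_injective ((((Tuple.sort τ).ofFn_comp_perm τ).trans
      (h.trans ((Tuple.sort τ').ofFn_comp_perm τ').symm)).eq_of_pairwise'
        (Tuple.monotone_sort τ).sortedLE_ofFn.pairwise
        (Tuple.monotone_sort τ').sortedLE_ofFn.pairwise)
  refine ⟨Tuple.sort τ * (Tuple.sort τ')⁻¹, ?_⟩
  funext j
  simpa using (congrFun hs ((Tuple.sort τ')⁻¹ j)).symm

theorem contDiffOn_wordDeriv {D : Set (Coord n × Jet 𝕜 n f N)} {L : Coord n × Jet 𝕜 n f N → 𝕜}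
    (hL : IsLagrangian D L) {U : Set (Coord n)} (hU : IsOpen U) {Φ : Coord n → Fin f → 𝕜}
    (hΦ : ContDiffOn ℝ ∞ Φ U) (hΦD : ∀ x ∈ U, (x, jet N Φ x) ∈ D) (B : Fin f)
    (w : List (Fin n)) : ContDiffOn ℝ ∞ (wordDeriv L Φ B w) U := by
  by_cases h : w.length ≤ N
  · have : wordDeriv L Φ B w = fun y => lagrangianDeriv L B h w.get (y, jet N Φ y) := by
      funext y
      rw [wordDeriv, dif_pos h]
    rw [this]
    exact (hL.contDiffOn_lagrangianDeriv B h w.get).comp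
      (contDiffOn_id.prodMk (contDiffOn_jet hU hΦ)) hΦD
  · have : wordDeriv L Φ B w = fun y => 0 := by
      funext y
      rw [wordDeriv, dif_neg h]
    rw [this]
    exact contDiffOn_const

theorem wordDeriv_perm {D : Set (Coord n × Jet 𝕜 n f N)} {L : Coord n × Jet 𝕜 n f N → 𝕜}
    (hL : IsLagrangian D L) {U : Set (Coord n)} (hU : IsOpen U) {Φ : Coord n → Fin f → 𝕜}
    (hΦ : ContDiffOn ℝ ∞ Φ U) (hΦD : ∀ x ∈ U, (x, jet N Φ x) ∈ D) (B : Fin f)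
    (w w' : List (Fin n)) (h : w.Perm w') : EqOn (wordDeriv L Φ B w) (wordDeriv L Φ B w') U := by
  intro x hx
  by_cases hw : w.length ≤ N
  · obtain ⟨k, τ, rfl⟩ : ∃ (k : ℕ) (τ : Fin k → Fin n), w = List.ofFn τ :=
      ⟨w.length, w.get, by simp⟩
    obtain ⟨k', τ', rfl⟩ : ∃ (k : ℕ) (τ : Fin k → Fin n), w' = List.ofFn τ :=
      ⟨w'.length, w'.get, by simp⟩
    obtain rfl : k = k' := by simpa using h.length_eq
    obtain ⟨σ, rfl⟩ := exists_perm_of_ofFn_perm h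
    have hk : k ≤ N := by simpa using hw
    rw [wordDeriv_ofFn L Φ B hk, wordDeriv_ofFn L Φ B hk]
    exact (hL.lagrangianDeriv_comp_perm (hΦD x hx) (symmetrize_jet hU hΦ hx) B hk τ σ).symm
  · rw [wordDeriv, wordDeriv, dif_neg hw, dif_neg (h.length_eq ▸ hw)]

end LagrangianDerivatives

/-! ### The Noether current: smoothness, and divergence on a solution -/

section Current

variable {𝕜 : Type*} [RCLike 𝕜] {n f N r : ℕ}

theorem fderiv_param_eq {E W G : Type*} [NormedAddCommGroup E] [NormedSpace ℝ E]
    [NormedAddCommGroup W] [NormedSpace ℝ W] [NormedAddCommGroup G] [NormedSpace ℝ G]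
    {S : Set (E × W)} (hS : IsOpen S) {H : E × W → G} (hH : ContDiffOn ℝ ∞ H S) {x : E} {ε : W}
    (hx : (x, ε) ∈ S) (v : W) :
    fderiv ℝ (fun ε' => H (x, ε')) ε v = dirDeriv ((0 : E), v) H (x, ε) := by
  have h : HasFDerivAt (fun ε' => H (x, ε'))
      ((fderiv ℝ H (x, ε)).comp (ContinuousLinearMap.inr ℝ E W)) ε :=
    HasFDerivAt.comp ε (ContDiffOn.differentiableAt_of_isOpen hH hS hx).hasFDerivAt
      (hasFDerivAt_prodMk_right x ε)
  rw [h.fderiv]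
  rfl

/-- A parameter derivative is the joint derivative in the direction (0, v), hence smooth in x. This
gives smoothness of the generators. -/
theorem contDiffOn_fderiv_param {E W G : Type*} [NormedAddCommGroup E] [NormedSpace ℝ E]
    [NormedAddCommGroup W] [NormedSpace ℝ W] [NormedAddCommGroup G] [NormedSpace ℝ G]
    {U : Set E} (hU : IsOpen U) {V : Set W} (hV : IsOpen V) {ε : W} (hε : ε ∈ V)
    {H : E × W → G} (hH : ContDiffOn ℝ ∞ H (U ×ˢ V)) (v : W) :
    ContDiffOn ℝ ∞ (fun x => fderiv ℝ (fun ε' => H (x, ε')) ε v) U :=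
  ((contDiffOn_dirDeriv (hU.prod hV) hH ((0 : E), v)).comp
    (contDiffOn_id.prodMk contDiffOn_const) fun _ hx => ⟨hx, hε⟩).congr
    fun _ hx => fderiv_param_eq (hU.prod hV) hH ⟨hx, hε⟩ v

theorem contDiffOn_coordGenerator {U : Set (Coord n)} (hU : IsOpen U) {V : Set (Fin r → ℝ)}
    (hV : IsOpen V) (hV0 : (0 : Fin r → ℝ) ∈ V) {δx : Coord n → (Fin r → ℝ) → Coord n}
    (hδx : ContDiffOn ℝ ∞ (fun p : Coord n × (Fin r → ℝ) => δx p.1 p.2) (U ×ˢ V)) (α : Fin r)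
    (s : Fin n) : ContDiffOn ℝ ∞ (coordGenerator δx α s) U :=
  contDiffOn_fderiv_param hU hV hV0 (contDiffOn_pi.1 hδx s) (Pi.single α 1)

theorem contDiffOn_fieldGenerator {U : Set (Coord n)} (hU : IsOpen U) {V : Set (Fin r → ℝ)}
    (hV : IsOpen V) (hV0 : (0 : Fin r → ℝ) ∈ V) {δΦ : Coord n → (Fin r → ℝ) → Fin f → 𝕜}
    (hδΦ : ContDiffOn ℝ ∞ (fun p : Coord n × (Fin r → ℝ) => δΦ p.1 p.2) (U ×ˢ V)) (α : Fin r)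
    (B : Fin f) : ContDiffOn ℝ ∞ (fieldGenerator δΦ α B) U :=
  contDiffOn_fderiv_param hU hV hV0 (contDiffOn_pi.1 hδΦ B) (Pi.single α 1)

theorem contDiffOn_ofReal {E : Type*} [NormedAddCommGroup E] [NormedSpace ℝ E] {U : Set E}
    {F : E → ℝ} (hF : ContDiffOn ℝ ∞ F U) : ContDiffOn ℝ ∞ (fun y => (F y : 𝕜)) U :=
  (RCLike.ofRealCLM (K := 𝕜)).contDiff.comp_contDiffOn hF

/-- The variation of the fields at a fixed point,
`∂δΦ_B/∂ε^α - (∂δx^s/∂ε^α) ∂_s Φ_B`. -/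
def fixedPointVariation (Φ : Coord n → Fin f → 𝕜) (δx : Coord n → (Fin r → ℝ) → Coord n)
    (δΦ : Coord n → (Fin r → ℝ) → Fin f → 𝕜) (α : Fin r) (y : Coord n) (B : Fin f) : 𝕜 :=
  fieldGenerator δΦ α B y -
    ∑ s : Fin n, (coordGenerator δx α s y : 𝕜) * pderiv s (fun z => Φ z B) y

theorem contDiffOn_fixedPointVariation {U : Set (Coord n)} (hU : IsOpen U)
    {Φ : Coord n → Fin f → 𝕜} (hΦ : ContDiffOn ℝ ∞ Φ U) {V : Set (Fin r → ℝ)} (hV : IsOpen V)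
    (hV0 : (0 : Fin r → ℝ) ∈ V) {δx : Coord n → (Fin r → ℝ) → Coord n}
    (hδx : ContDiffOn ℝ ∞ (fun p : Coord n × (Fin r → ℝ) => δx p.1 p.2) (U ×ˢ V))
    {δΦ : Coord n → (Fin r → ℝ) → Fin f → 𝕜}
    (hδΦ : ContDiffOn ℝ ∞ (fun p : Coord n × (Fin r → ℝ) => δΦ p.1 p.2) (U ×ˢ V)) (α : Fin r) :
    ContDiffOn ℝ ∞ (fixedPointVariation Φ δx δΦ α) U :=
  contDiffOn_pi.2 fun B => (contDiffOn_fieldGenerator hU hV hV0 hδΦ α B).sub <|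
    ContDiffOn.sum fun s _ =>
      (contDiffOn_ofReal (contDiffOn_coordGenerator hU hV hV0 hδx α s)).mul
        (contDiffOn_dirDeriv hU (contDiffOn_component hΦ B) _)

/-- Here Y < N - Z, so every word has length Y + Z + 1 ≤ N and the default value of `wordDeriv`
never enters. -/
theorem momentum_eq_sum_range (L : Coord n × Jet 𝕜 n f N → 𝕜) (Φ : Coord n → Fin f → 𝕜)
    (B : Fin f) (l : Fin n) (Z : Fin N) (ν : Fin Z → Fin n) (x : Coord n) :
    momentum L Φ B l Z ν x = ∑ Y ∈ Finset.range (N - Z), (-1) ^ Y * ∑ μ : Fin Y → Fin n,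
      iterPderiv μ (wordDeriv L Φ B (l :: (List.ofFn μ ++ List.ofFn ν))) x := by
  rw [Finset.sum_range, momentum]
  refine Finset.sum_congr rfl fun Y _ => ?_
  congr 1
  refine Finset.sum_congr rfl fun μ _ => ?_
  rw [← wordDeriv_ofFn L Φ B]
  congr 2
  rw [List.ofFn_cons, List.ofFn_fin_append]

theorem noetherCurrent_eq (L : Coord n × Jet 𝕜 n f N → 𝕜) (Φ : Coord n → Fin f → 𝕜)
    (δx : Coord n → (Fin r → ℝ) → Coord n) (δΦ : Coord n → (Fin r → ℝ) → Fin f → 𝕜)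
    (α : Fin r) (l : Fin n) :
    noetherCurrent L Φ δx δΦ α l = fun x =>
      (∑ B : Fin f, ∑ Z ∈ Finset.range N, ∑ Y ∈ Finset.range (N - Z), (-1) ^ Y *
        pairingCurrent (wordDeriv L Φ B) (fun y => fixedPointVariation Φ δx δΦ α y B) Y Z l x) +
      (coordGenerator δx α l x : 𝕜) * L (x, jet N Φ x) := by
  funext x
  rw [noetherCurrent]
  congr 1
  refine Finset.sum_congr rfl fun B _ => ?_
  rw [Finset.sum_range]
  refine Finset.sum_congr rfl fun Z _ => ?_
  simp only [momentum_eq_sum_range, pairingCurrent, Finset.mul_sum]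
  rw [Finset.sum_comm]
  refine Finset.sum_congr rfl fun Y _ => ?_
  rw [Finset.sum_comm]
  refine Finset.sum_congr rfl fun μ _ => Finset.sum_congr rfl fun ν _ => ?_
  simp only [fixedPointVariation]
  ring

/-- This end of the telescoping, with all derivatives on η, is the linearization of L along the jet
of η. -/
theorem sum_pairing_zero {D : Set (Coord n × Jet 𝕜 n f N)} {L : Coord n × Jet 𝕜 n f N → 𝕜}
    (hL : IsLagrangian D L) (Φ : Coord n → Fin f → 𝕜) (η : Coord n → Fin f → 𝕜) {x : Coord n}
    (hx : (x, jet N Φ x) ∈ D) :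
    ∑ B : Fin f, ∑ Z ∈ Finset.range (N + 1), pairing (wordDeriv L Φ B) (fun y => η y B) 0 Z x =
      fderiv ℝ L (x, jet N Φ x) (0, jet N η x) := by
  rw [hL.fderiv_apply_eq_sum hx]
  refine Finset.sum_congr rfl fun B _ => ?_
  rw [Finset.sum_range]
  refine Finset.sum_congr rfl fun X _ => ?_
  simp only [pairing, Fintype.sum_unique, iterPderiv, List.ofFn_zero, List.nil_append]
  refine Finset.sum_congr rfl fun τ _ => ?_
  rw [wordDeriv_ofFn L Φ B (Nat.le_of_lt_succ X.2)]
  rfl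

/-- The other end of the telescoping, with all derivatives on ∂L, which vanishes on a solution. -/
theorem sum_pairing_eq_eulerLagrange (L : Coord n × Jet 𝕜 n f N → 𝕜) (Φ : Coord n → Fin f → 𝕜)
    (B : Fin f) (η : Coord n → 𝕜) (x : Coord n) :
    ∑ Y ∈ Finset.range (N + 1), (-1) ^ Y * pairing (wordDeriv L Φ B) η Y 0 x =
      eulerLagrange L Φ B x * η x := by
  rw [Finset.sum_range, eulerLagrange, Finset.sum_mul]
  refine Finset.sum_congr rfl fun X _ => ?_
  rw [mul_assoc, Finset.sum_mul]
  simp only [pairing, Fintype.sum_unique, iterPderiv, List.ofFn_zero, List.append_nil]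
  congr 1
  refine Finset.sum_congr rfl fun τ _ => ?_
  rw [wordDeriv_ofFn L Φ B (Nat.le_of_lt_succ X.2)]

theorem contDiffOn_lagrangian_jet {D : Set (Coord n × Jet 𝕜 n f N)}
    {L : Coord n × Jet 𝕜 n f N → 𝕜} (hL : IsLagrangian D L) {U : Set (Coord n)} (hU : IsOpen U)
    {Φ : Coord n → Fin f → 𝕜} (hΦ : ContDiffOn ℝ ∞ Φ U) (hΦD : ∀ x ∈ U, (x, jet N Φ x) ∈ D) :
    ContDiffOn ℝ ∞ (fun y => L (y, jet N Φ y)) U :=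
  hL.contDiffOn.comp (contDiffOn_id.prodMk (contDiffOn_jet hU hΦ)) hΦD

section

variable {U : Set (Coord n)} (hU : IsOpen U)
  {D : Set (Coord n × Jet 𝕜 n f N)} {L : Coord n × Jet 𝕜 n f N → 𝕜} (hL : IsLagrangian D L)
  {Φ : Coord n → Fin f → 𝕜} (hΦ : ContDiffOn ℝ ∞ Φ U) (hΦD : ∀ x ∈ U, (x, jet N Φ x) ∈ D)
  {V : Set (Fin r → ℝ)} (hV : IsOpen V) (hV0 : (0 : Fin r → ℝ) ∈ V)
  {δx : Coord n → (Fin r → ℝ) → Coord n}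
  (hδx : ContDiffOn ℝ ∞ (fun p : Coord n × (Fin r → ℝ) => δx p.1 p.2) (U ×ˢ V))
  {δΦ : Coord n → (Fin r → ℝ) → Fin f → 𝕜}
  (hδΦ : ContDiffOn ℝ ∞ (fun p : Coord n × (Fin r → ℝ) => δΦ p.1 p.2) (U ×ˢ V))

include hU hL hΦ hΦD hV hV0 hδx hδΦ

theorem contDiffOn_noetherCurrent (α : Fin r) (l : Fin n) :
    ContDiffOn ℝ ∞ (noetherCurrent L Φ δx δΦ α l) U := by
  rw [noetherCurrent_eq]
  refine ContDiffOn.add (ContDiffOn.sum fun B _ => ContDiffOn.sum fun Z _ =>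
    ContDiffOn.sum fun Y _ => contDiffOn_const.mul (contDiffOn_pairingCurrent hU
      (contDiffOn_wordDeriv hL hU hΦ hΦD B) (contDiffOn_component
        (contDiffOn_fixedPointVariation hU hΦ hV hV0 hδx hδΦ α) B) Y Z l))
    ((contDiffOn_ofReal (contDiffOn_coordGenerator hU hV hV0 hδx α l)).mul
      (contDiffOn_lagrangian_jet hL hU hΦ hΦD))

theorem divergence_noetherCurrent (hEL : ∀ B : Fin f, ∀ x ∈ U, eulerLagrange L Φ B x = 0)
    (α : Fin r) {x : Coord n} (hx : x ∈ U) :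
    ∑ l : Fin n, pderiv l (noetherCurrent L Φ δx δΦ α l) x =
      fderiv ℝ L (x, jet N Φ x) (0, jet N (fixedPointVariation Φ δx δΦ α) x) +
      ∑ l : Fin n, pderiv l (fun y => (coordGenerator δx α l y : 𝕜) * L (y, jet N Φ y)) x := by
  have hη := contDiffOn_fixedPointVariation hU hΦ hV hV0 hδx hδΦ α
  have hJ : ∀ B l, ContDiffOn ℝ ∞ (fun y => ∑ Z ∈ Finset.range N, ∑ Y ∈ Finset.range (N - Z),
      (-1) ^ Y * pairingCurrent (wordDeriv L Φ B)
        (fun y => fixedPointVariation Φ δx δΦ α y B) Y Z l y) U := fun B l =>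
    ContDiffOn.sum fun Z _ => ContDiffOn.sum fun Y _ =>
      contDiffOn_const.mul (contDiffOn_pairingCurrent hU
        (contDiffOn_wordDeriv hL hU hΦ hΦD B) (contDiffOn_component hη B) Y Z l)
  have hl : ∀ l, pderiv l (noetherCurrent L Φ δx δΦ α l) x =
      ∑ B, pderiv l (fun y => ∑ Z ∈ Finset.range N, ∑ Y ∈ Finset.range (N - Z),
        (-1) ^ Y * pairingCurrent (wordDeriv L Φ B)
          (fun y => fixedPointVariation Φ δx δΦ α y B) Y Z l y) x +
      pderiv l (fun y => (coordGenerator δx α l y : 𝕜) * L (y, jet N Φ y)) x := by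
    intro l
    have h1 : ∀ B ∈ Finset.univ, DifferentiableAt ℝ (fun y => ∑ Z ∈ Finset.range N,
        ∑ Y ∈ Finset.range (N - Z), (-1) ^ Y * pairingCurrent (wordDeriv L Φ B)
          (fun y => fixedPointVariation Φ δx δΦ α y B) Y Z l y) x := fun B _ =>
      ContDiffOn.differentiableAt_of_isOpen (hJ B l) hU hx
    have h2 : DifferentiableAt ℝ
        (fun y => (coordGenerator δx α l y : 𝕜) * L (y, jet N Φ y)) x :=
      ContDiffOn.differentiableAt_of_isOpen
        ((contDiffOn_ofReal (contDiffOn_coordGenerator hU hV hV0 hδx α l)).mul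
          (contDiffOn_lagrangian_jet hL hU hΦ hΦD)) hU hx
    rw [noetherCurrent_eq]
    simp only [pderiv_eq_dirDeriv]
    rw [← dirDeriv_sum h1, dirDeriv, fderiv_fun_add (DifferentiableAt.fun_sum h1) h2]
    rfl
  simp only [hl, Finset.sum_add_distrib]
  congr 1
  rw [Finset.sum_comm, ← sum_pairing_zero hL Φ _ (hΦD x hx)]
  refine Finset.sum_congr rfl fun B _ => ?_
  rw [divergence_sum_pairingCurrent hU (contDiffOn_wordDeriv hL hU hΦ hΦD B)
    (wordDeriv_perm hL hU hΦ hΦD B) (contDiffOn_component hη B) N hx,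
    sum_pairing_eq_eulerLagrange, hEL B x hx, zero_mul, sub_zero]

end

end Current

/-! ### Determinants, local inverses, slices at fixed time, and localization of integrals -/

section AnalyticTools

variable {𝕜 : Type*} [RCLike 𝕜] {n f N r : ℕ}

theorem contDiff_det :
    ContDiff ℝ ∞ fun A : Fin n → Fin n → ℝ => (Matrix.of A).det := by
  simp only [Matrix.det_apply, Matrix.of_apply]
  fun_prop

theorem fderiv_det_one (H : Fin n → Fin n → ℝ) :
    fderiv ℝ (fun A : Fin n → Fin n → ℝ => (Matrix.of A).det)
      (fun i j => if i = j then 1 else 0) H = ∑ i, H i i := by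
  have hd := (contDiff_det (n := n)).differentiable (by simp)
    (fun i j => if i = j then 1 else 0)
  rw [← hd.lineDeriv_eq_fderiv, lineDeriv]
  have hone : Matrix.of (fun i j : Fin n => if i = j then (1 : ℝ) else 0) = 1 := by
    ext i j
    rw [Matrix.of_apply, Matrix.one_apply]
  -- det(1 + tH) = 1 + t tr H + t² q(t) with q a polynomial, so the line derivative at 0 is the
  -- trace.
  have h : ∀ t : ℝ, (Matrix.of ((fun i j => if i = j then 1 else 0) + t • H)).det =
      1 + Matrix.trace (Matrix.of H) * t +
        (Matrix.det (1 + (Polynomial.X : Polynomial ℝ) •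
          (Matrix.of H).map Polynomial.C)).divX.divX.eval t * t ^ 2 := fun t => by
    rw [← Matrix.det_one_add_smul t (Matrix.of H), ← hone]
    rfl
  simp only [h]
  generalize (Matrix.det (1 + (Polynomial.X : Polynomial ℝ) •
          (Matrix.of H).map Polynomial.C)).divX.divX = q
  have h1 : HasDerivAt (fun t : ℝ => 1 + Matrix.trace (Matrix.of H) * t + q.eval t * t ^ 2)
      (Matrix.trace (Matrix.of H) * 1 +
        (q.derivative.eval 0 * 0 ^ 2 + q.eval 0 * (2 * 0 ^ 1 * 1))) 0 := by
    have := (((hasDerivAt_id (0 : ℝ)).const_mul (Matrix.trace (Matrix.of H))).const_add 1).add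
      ((q.hasDerivAt 0).mul ((hasDerivAt_id (0 : ℝ)).pow 2))
    exact this.congr_deriv (by simp)
  rw [h1.deriv]
  simp [Matrix.trace]

/-- A smooth map is, near a point where its derivative is invertible, an open partial
homeomorphism with smooth inverse. -/
theorem exists_openPartialHomeomorph {E : Type*} [NormedAddCommGroup E] [NormedSpace ℝ E]
    [CompleteSpace E] {S : Set E} (hS : IsOpen S) {X : E → E} (hX : ContDiffOn ℝ ∞ X S) {p : E}
    (hp : p ∈ S) (X' : E ≃L[ℝ] E) (hX' : fderiv ℝ X p = X') :
    ∃ e : OpenPartialHomeomorph E E, p ∈ e.source ∧ e.source ⊆ S ∧ (e : E → E) = X ∧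
      ContDiffOn ℝ ∞ e.symm e.target := by
  have hXp := hX.contDiffAt (hS.mem_nhds hp)
  have hd : HasFDerivAt X (X' : E →L[ℝ] E) p :=
    hX' ▸ (ContDiffOn.differentiableAt_of_isOpen hX hS hp).hasFDerivAt
  -- Restricting to points with invertible derivative makes the inverse smooth on the whole target,
  -- not only at the image of `p`.
  let R := S ∩ fderiv ℝ X ⁻¹' range ((↑) : (E ≃L[ℝ] E) → E →L[ℝ] E)
  have hR : IsOpen R := (hX.continuousOn_fderiv_of_isOpen hS (by simp)).isOpen_inter_preimage hS
    ContinuousLinearEquiv.isOpen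
  let e := (hXp.toOpenPartialHomeomorph X hd (by simp)).restrOpen R hR
  refine ⟨e, ⟨hXp.mem_toOpenPartialHomeomorph_source hd (by simp), hp, X', hX'.symm⟩,
    fun q hq => hq.2.1, rfl, fun a ha => ContDiffAt.contDiffWithinAt ?_⟩
  obtain ⟨hq, Y, hY⟩ := (e.map_target ha).2
  exact e.contDiffAt_symm ha
    (hY ▸ (ContDiffOn.differentiableAt_of_isOpen hX hS hq).hasFDerivAt : HasFDerivAt X
      (Y : E →L[ℝ] E) (e.symm a)) (hX.contDiffAt (hS.mem_nhds hq))

theorem isOpen_slice {E W : Type*} [TopologicalSpace E] [TopologicalSpace W] {S : Set (E × W)}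
    (hS : IsOpen S) (t : W) : IsOpen {y | (y, t) ∈ S} :=
  hS.preimage (Continuous.prodMk_left t)

theorem contDiffOn_slice {E W G : Type*} [NormedAddCommGroup E] [NormedSpace ℝ E]
    [NormedAddCommGroup W] [NormedSpace ℝ W] [NormedAddCommGroup G] [NormedSpace ℝ G]
    {S : Set (E × W)} {F : E × W → G} (hF : ContDiffOn ℝ ∞ F S) (t : W) :
    ContDiffOn ℝ ∞ (fun y => F (y, t)) {y | (y, t) ∈ S} :=
  hF.comp (contDiff_prodMk_left t).contDiffOn fun _ hy => hy

theorem dirDeriv_slice {E W G : Type*} [NormedAddCommGroup E] [NormedSpace ℝ E]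
    [NormedAddCommGroup W] [NormedSpace ℝ W] [NormedAddCommGroup G] [NormedSpace ℝ G]
    {S : Set (E × W)} (hS : IsOpen S) {F : E × W → G} (hF : ContDiffOn ℝ ∞ F S) {y : E} {t : W}
    (h : (y, t) ∈ S) (v : E) :
    dirDeriv v (fun z => F (z, t)) y = dirDeriv (v, (0 : W)) F (y, t) := by
  have hc : HasFDerivAt (fun z => F (z, t))
      ((fderiv ℝ F (y, t)).comp (ContinuousLinearMap.inl ℝ E W)) y :=
    HasFDerivAt.comp y (ContDiffOn.differentiableAt_of_isOpen hF hS h).hasFDerivAt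
      (hasFDerivAt_prodMk_left y t)
  rw [dirDeriv, hc.fderiv]
  rfl

/-- Space derivatives at frozen t are joint derivatives in directions (v, 0), so they are jointly
smooth in (y, t) and commute with ∂_t. -/
theorem listDeriv_slice {E W G : Type*} [NormedAddCommGroup E] [NormedSpace ℝ E]
    [NormedAddCommGroup W] [NormedSpace ℝ W] [NormedAddCommGroup G] [NormedSpace ℝ G]
    {S : Set (E × W)} (hS : IsOpen S) {F : E × W → G} (hF : ContDiffOn ℝ ∞ F S) (t : W)
    (w : List E) :
    EqOn (listDeriv w fun z => F (z, t))
      (fun y => listDeriv (w.map fun v => (v, (0 : W))) F (y, t)) {y | (y, t) ∈ S} := by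
  induction w with
  | nil => exact fun _ _ => rfl
  | cons v w ih =>
    intro y hy
    rw [listDeriv_cons, dirDeriv_congr (isOpen_slice hS t) ih v hy,
      dirDeriv_slice hS (contDiffOn_listDeriv hS hF _) hy]
    rfl

theorem eq_zero_of_integral_ball_eq_zero {h : Coord n → 𝕜} {x : Coord n} {R : ℝ} (hR : 0 < R)
    (hc : ContinuousOn h (Metric.closedBall x R))
    (hint : ∀ ρ, 0 < ρ → ρ ≤ R → ∫ y in Metric.ball x ρ, h y = 0) : h x = 0 := by
  by_contra hne
  have hpos : 0 < ‖h x‖ / 2 := half_pos (norm_pos_iff.2 hne)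
  have hcx : ContinuousAt h x := hc.continuousAt (Metric.closedBall_mem_nhds x hR)
  obtain ⟨ρ', hρ', hb⟩ := Metric.continuousAt_iff.1 hcx _ hpos
  set ρ := min ρ' R with hρdef
  have hρ : 0 < ρ := lt_min hρ' hR
  have hvol : (0 : ℝ) < volume.real (Metric.ball x ρ) :=
    ENNReal.toReal_pos (Metric.measure_ball_pos _ _ hρ).ne' measure_ball_lt_top.ne
  have hi : IntegrableOn h (Metric.ball x ρ) :=
    (hc.integrableOn_compact (isCompact_closedBall x R)).mono_set
      (Metric.ball_subset_closedBall.trans (Metric.closedBall_subset_closedBall (min_le_right _ _)))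
  -- If the integral of h vanishes, that of h - h(x) has norm vol · ‖h(x)‖; by the choice of ρ it is
  -- at most half of that.
  have h1 : ∫ y in Metric.ball x ρ, (h y - h x) = -(volume.real (Metric.ball x ρ) • h x) := by
    rw [integral_sub hi (integrableOn_const measure_ball_lt_top.ne), hint ρ hρ (min_le_right _ _),
      setIntegral_const, zero_sub]
  have h2 : ‖∫ y in Metric.ball x ρ, (h y - h x)‖ ≤
      ‖h x‖ / 2 * volume.real (Metric.ball x ρ) :=
    norm_setIntegral_le_of_norm_le_const measure_ball_lt_top fun y hy => by
      rw [← dist_eq_norm]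
      exact (hb ((Metric.mem_ball.1 hy).trans_le (min_le_left _ _))).le
  rw [h1, norm_neg, norm_smul, Real.norm_of_nonneg hvol.le] at h2
  nlinarith

/-- Differentiation under the integral: the t-derivative is bounded by a constant on the compact
product of closed balls. -/
theorem hasDerivAt_integral_ball {I : Coord n × ℝ → 𝕜} {T : Set (Coord n × ℝ)} (hT : IsOpen T)
    (hI : ContDiffOn ℝ ∞ I T) {x : Coord n} {ρ δ : ℝ} (hδ : 0 < δ)
    (hsub : Metric.closedBall x ρ ×ˢ Metric.closedBall (0 : ℝ) δ ⊆ T) :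
    HasDerivAt (fun t => ∫ y in Metric.ball x ρ, I (y, t))
      (∫ y in Metric.ball x ρ, dirDeriv ((0 : Coord n), (1 : ℝ)) I (y, 0)) 0 := by
  have hI' := contDiffOn_dirDeriv hT hI ((0 : Coord n), (1 : ℝ))
  obtain ⟨C, hC⟩ := ((isCompact_closedBall x ρ).prod
    (isCompact_closedBall (0 : ℝ) δ)).exists_bound_of_continuousOn (hI'.continuousOn.mono hsub)
  have hint : ∀ {F : Coord n × ℝ → 𝕜}, ContDiffOn ℝ ∞ F T → ∀ t ∈ Metric.closedBall (0 : ℝ) δ,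
      IntegrableOn (fun y => F (y, t)) (Metric.ball x ρ) := fun hF t ht =>
    (((contDiffOn_slice hF t).continuousOn.mono fun y hy =>
      hsub ⟨hy, ht⟩).integrableOn_compact (isCompact_closedBall x ρ)).mono_set
      Metric.ball_subset_closedBall
  have h0 : (0 : ℝ) ∈ Metric.closedBall (0 : ℝ) δ := Metric.mem_closedBall_self hδ.le
  refine (hasDerivAt_integral_of_dominated_loc_of_deriv_le (𝕜 := ℝ)
    (F := fun t y => I (y, t)) (F' := fun t y => dirDeriv ((0 : Coord n), (1 : ℝ)) I (y, t))
    (bound := fun _ => C) (Metric.ball_mem_nhds 0 hδ) ?_ (hint hI 0 h0)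
    (hint hI' 0 h0).aestronglyMeasurable ?_ (integrableOn_const measure_ball_lt_top.ne) ?_).2
  · filter_upwards [Metric.ball_mem_nhds (0 : ℝ) hδ] with t ht
    exact (hint hI t (Metric.ball_subset_closedBall ht)).aestronglyMeasurable
  · refine (ae_restrict_iff' measurableSet_ball).2 (Filter.Eventually.of_forall fun y hy t ht => ?_)
    exact hC (y, t) ⟨Metric.ball_subset_closedBall hy, Metric.ball_subset_closedBall ht⟩
  · refine (ae_restrict_iff' measurableSet_ball).2 (Filter.Eventually.of_forall fun y hy t ht => ?_)
    have hd := (ContDiffOn.differentiableAt_of_isOpen hI hT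
      (hsub (a := (y, t))
        ⟨Metric.ball_subset_closedBall hy, Metric.ball_subset_closedBall ht⟩)).hasFDerivAt
    exact hd.comp_hasDerivAt t ((hasDerivAt_const t y).prodMk (hasDerivAt_id t))

/-- If the integrals of `I (·, t)` over all small balls around `x` are stationary at `t = 0`, then
so is `I (x, ·)`. -/
theorem dirDeriv_eq_zero_of_integral_isLittleO {I : Coord n × ℝ → 𝕜} {T : Set (Coord n × ℝ)}
    (hT : IsOpen T) (hI : ContDiffOn ℝ ∞ I T) {x : Coord n} {R δ : ℝ} (hR : 0 < R) (hδ : 0 < δ)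
    (hsub : Metric.closedBall x R ×ˢ Metric.closedBall (0 : ℝ) δ ⊆ T)
    (ho : ∀ ρ, 0 < ρ → ρ ≤ R →
      (fun t => (∫ y in Metric.ball x ρ, I (y, t)) - ∫ y in Metric.ball x ρ, I (y, 0))
        =o[𝓝 0] fun t : ℝ => t) :
    dirDeriv ((0 : Coord n), (1 : ℝ)) I (x, 0) = 0 := by
  have hI' := contDiffOn_dirDeriv hT hI ((0 : Coord n), (1 : ℝ))
  refine eq_zero_of_integral_ball_eq_zero (h := fun y => dirDeriv ((0 : Coord n), (1 : ℝ)) I (y, 0))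
    hR ((contDiffOn_slice hI' 0).continuousOn.mono fun y hy =>
      hsub ⟨hy, Metric.mem_closedBall_self hδ.le⟩) fun ρ hρ hρR => ?_
  have h1 := hasDerivAt_integral_ball hT hI hδ
    ((prod_mono (Metric.closedBall_subset_closedBall hρR) subset_rfl).trans hsub)
  refine h1.unique ?_
  rw [hasDerivAt_iff_isLittleO]
  simpa using ho ρ hρ hρR

end AnalyticTools

/-! ### Calculus rules for directional derivatives -/

section DirectionalDerivativeRules

variable {E F G : Type*} [NormedAddCommGroup E] [NormedSpace ℝ E] [NormedAddCommGroup F]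
  [NormedSpace ℝ F] [NormedAddCommGroup G] [NormedSpace ℝ G]

theorem dirDeriv_comp {h : F → G} {g : E → F} {x : E} (hh : DifferentiableAt ℝ h (g x))
    (hg : DifferentiableAt ℝ g x) (v : E) :
    dirDeriv v (fun y => h (g y)) x = dirDeriv (dirDeriv v g x) h (g x) := by
  have := (hh.hasFDerivAt.comp x hg.hasFDerivAt).fderiv
  rw [dirDeriv, dirDeriv, dirDeriv, ← ContinuousLinearMap.comp_apply, ← this]
  rfl

theorem dirDeriv_add_direction (v w : E) (h : E → G) (x : E) :
    dirDeriv (v + w) h x = dirDeriv v h x + dirDeriv w h x :=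
  map_add _ _ _

theorem dirDeriv_add {g h : E → G} {x : E} (hg : DifferentiableAt ℝ g x)
    (hh : DifferentiableAt ℝ h x) (v : E) :
    dirDeriv v (fun y => g y + h y) x = dirDeriv v g x + dirDeriv v h x := by
  simp only [dirDeriv]
  rw [fderiv_fun_add hg hh]
  rfl

theorem dirDeriv_prodMk {g : E → F} {h : E → G} {x : E} (hg : DifferentiableAt ℝ g x)
    (hh : DifferentiableAt ℝ h x) (v : E) :
    dirDeriv v (fun y => (g y, h y)) x = (dirDeriv v g x, dirDeriv v h x) := by
  simp only [dirDeriv]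
  rw [hg.fderiv_prodMk hh]
  rfl

theorem dirDeriv_pi {ι : Type*} [Fintype ι] {g : E → ι → G} {x : E}
    (hg : ∀ i, DifferentiableAt ℝ (fun y => g y i) x) (v : E) :
    dirDeriv v g x = fun i => dirDeriv v (fun y => g y i) x := by
  funext i
  have : g = fun y i => g y i := rfl
  rw [dirDeriv, this, fderiv_pi hg]
  rfl

theorem dirDeriv_fst (v : E × F) (x : E × F) : dirDeriv v Prod.fst x = v.1 := by
  rw [dirDeriv, fderiv_fst]
  rfl

theorem dirDeriv_snd (v : E × F) (x : E × F) : dirDeriv v Prod.snd x = v.2 := by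
  rw [dirDeriv, fderiv_snd]
  rfl

theorem dirDeriv_coord {n : ℕ} (v : Coord n) (h : Coord n → G) (x : Coord n) :
    dirDeriv v h x = ∑ s, v s • dirDeriv (Pi.single s 1) h x := by
  simp only [dirDeriv]
  conv_lhs => rw [← Finset.univ_sum_single v, map_sum]
  refine Finset.sum_congr rfl fun s _ => ?_
  rw [← map_smul, ← Pi.single_smul', smul_eq_mul, mul_one]

theorem differentiableAt_ofReal {𝕜 : Type*} [RCLike 𝕜] {g : E → ℝ} {x : E}
    (hg : DifferentiableAt ℝ g x) : DifferentiableAt ℝ (fun y => (g y : 𝕜)) x :=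
  (RCLike.ofRealCLM (K := 𝕜)).differentiableAt.comp x hg

theorem dirDeriv_ofReal {𝕜 : Type*} [RCLike 𝕜] {g : E → ℝ} {x : E}
    (hg : DifferentiableAt ℝ g x) (v : E) :
    dirDeriv v (fun y => (g y : 𝕜)) x = ((dirDeriv v g x : ℝ) : 𝕜) := by
  have := ((RCLike.ofRealCLM (K := 𝕜)).hasFDerivAt.comp x hg.hasFDerivAt).fderiv
  simp only [dirDeriv]
  rw [← RCLike.ofRealCLM_apply, ← ContinuousLinearMap.comp_apply, ← this]
  rfl

end DirectionalDerivativeRules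

/-! ### The one-parameter flow in space-time and its Jacobian -/

section Flow

variable {𝕜 : Type*} [RCLike 𝕜] {n f N r : ℕ}

/-- The map `(x, t) ↦ (x + a(x, t), t)`. -/
def flowMap (a : Coord n × ℝ → Coord n) (p : Coord n × ℝ) : Coord n × ℝ := (p.1 + a p, p.2)

/-- The velocity `∂ₜ a` at `t = 0`. -/
def velocity {G : Type*} [NormedAddCommGroup G] [NormedSpace ℝ G] (a : Coord n × ℝ → G)
    (x : Coord n) : G :=
  dirDeriv ((0 : Coord n), (1 : ℝ)) a (x, 0)

/-- The Jacobian determinant of `x ↦ x + a(x, t)`. -/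
def flowJacobian (a : Coord n × ℝ → Coord n) (p : Coord n × ℝ) : ℝ :=
  (Matrix.of fun i j => (if i = j then 1 else 0) +
    dirDeriv ((Pi.single j 1 : Coord n), (0 : ℝ)) (fun q => a q i) p).det

section

variable {U : Set (Coord n)} {S : Set (Coord n × ℝ)} (hU : IsOpen U)
  (hS : IsOpen S) (h0 : ∀ x ∈ U, (x, (0 : ℝ)) ∈ S) {a : Coord n × ℝ → Coord n}
  (ha : ContDiffOn ℝ ∞ a S) (ha0 : ∀ x ∈ U, a (x, 0) = 0)

include ha in
theorem contDiffOn_flowMap : ContDiffOn ℝ ∞ (flowMap a) S :=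
  (contDiffOn_fst.add ha).prodMk contDiffOn_snd

include hS ha in
theorem contDiffOn_flowJacobian : ContDiffOn ℝ ∞ (flowJacobian a) S :=
  contDiff_det.comp_contDiffOn <| contDiffOn_pi.2 fun i => contDiffOn_pi.2 fun _ =>
    contDiffOn_const.add (contDiffOn_dirDeriv hS (contDiffOn_pi.1 ha i) _)

theorem flowMap_zero {x : Coord n} (h : a (x, 0) = 0) : flowMap a (x, 0) = (x, 0) := by
  simp [flowMap, h]

include hU hS h0 in
theorem dirDeriv_space_eq_zero {G : Type*} [NormedAddCommGroup G] [NormedSpace ℝ G]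
    {b : Coord n × ℝ → G} (hb : ContDiffOn ℝ ∞ b S) (hb0 : ∀ x ∈ U, b (x, 0) = 0) {x : Coord n}
    (hx : x ∈ U) (v : Coord n) : dirDeriv (v, (0 : ℝ)) b (x, 0) = 0 := by
  have : EqOn (fun z => b (z, 0)) (fun _ => 0) U := hb0
  rw [← dirDeriv_slice hS hb (h0 x hx), dirDeriv_congr hU this v hx, dirDeriv]
  simp

include hS h0 ha in
theorem dirDeriv_flowMap_time {x : Coord n} (hx : x ∈ U) :
    dirDeriv ((0 : Coord n), (1 : ℝ)) (flowMap a) (x, 0) = (velocity a x, 1) := by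
  have hd := ContDiffOn.differentiableAt_of_isOpen ha hS (h0 x hx)
  have : flowMap a = fun p => (p.1 + a p, p.2) := rfl
  rw [this, dirDeriv_prodMk (differentiableAt_fst.fun_add hd) differentiableAt_snd,
    dirDeriv_add differentiableAt_fst hd, dirDeriv_fst, dirDeriv_snd, zero_add]
  rfl

include hU hS h0 ha ha0

theorem dirDeriv_flowMap_space {x : Coord n} (hx : x ∈ U) (v : Coord n) :
    dirDeriv (v, (0 : ℝ)) (flowMap a) (x, 0) = (v, 0) := by
  have hd := ContDiffOn.differentiableAt_of_isOpen ha hS (h0 x hx)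
  have : flowMap a = fun p => (p.1 + a p, p.2) := rfl
  rw [this, dirDeriv_prodMk (differentiableAt_fst.fun_add hd) differentiableAt_snd,
    dirDeriv_add differentiableAt_fst hd, dirDeriv_space_eq_zero hU hS h0 ha ha0 hx, dirDeriv_fst,
    dirDeriv_snd, add_zero]

/-- With t as an extra coordinate, the derivative at (x, 0) is the shear (v, s) ↦ (v + s ȧ, s), with
inverse (v, s) ↦ (v - s ȧ, s). One use of the inverse function theorem thus inverts the maps for all
small t together, smoothly in t. -/
theorem exists_flow_openPartialHomeomorph {x : Coord n} (hx : x ∈ U) :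
    ∃ e : OpenPartialHomeomorph (Coord n × ℝ) (Coord n × ℝ), (x, (0 : ℝ)) ∈ e.source ∧
      e.source ⊆ S ∧ (e : Coord n × ℝ → Coord n × ℝ) = flowMap a ∧
      ContDiffOn ℝ ∞ e.symm e.target := by
  have hf : ∀ q : Coord n × ℝ, fderiv ℝ (flowMap a) (x, 0) q = (q.1 + q.2 • velocity a x, q.2) := by
    intro q
    have hq : q = (q.1, 0) + q.2 • ((0 : Coord n), (1 : ℝ)) := by ext <;> simp
    have h1 := dirDeriv_flowMap_space hU hS h0 ha ha0 hx q.1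
    have h2 := dirDeriv_flowMap_time hS h0 ha hx
    rw [dirDeriv] at h1 h2
    conv_lhs => rw [hq, map_add, map_smul, h1, h2]
    ext <;> simp
  refine exists_openPartialHomeomorph hS (contDiffOn_flowMap ha) (h0 x hx)
    (ContinuousLinearEquiv.equivOfInverse (fderiv ℝ (flowMap a) (x, 0))
      ((ContinuousLinearMap.fst ℝ (Coord n) ℝ -
        (ContinuousLinearMap.snd ℝ (Coord n) ℝ).smulRight (velocity a x)).prod
          (ContinuousLinearMap.snd ℝ (Coord n) ℝ)) (fun q => ?_) fun q => ?_) rfl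
  · rw [hf]
    ext <;> simp
  · rw [hf]
    ext <;> simp

theorem flowJacobian_zero {x : Coord n} (hx : x ∈ U) : flowJacobian a (x, 0) = 1 := by
  have h : ∀ i j, dirDeriv ((Pi.single j 1 : Coord n), (0 : ℝ)) (fun q => a q i) (x, 0) = 0 :=
    fun i j => dirDeriv_space_eq_zero hU hS h0 (contDiffOn_pi.1 ha i)
      (fun y hy => congrFun (ha0 y hy) i) hx _
  simp only [flowJacobian, h, add_zero]
  refine Eq.trans (congrArg Matrix.det ?_) (Matrix.det_one (n := Fin n) (R := ℝ))
  ext i j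
  rw [Matrix.of_apply, Matrix.one_apply]

/-- The Jacobian matrix is the identity at t = 0, where the derivative of the determinant is the
trace; exchanging ∂_t with ∂_i then gives the divergence of the velocity. -/
theorem dirDeriv_flowJacobian {x : Coord n} (hx : x ∈ U) :
    dirDeriv ((0 : Coord n), (1 : ℝ)) (flowJacobian a) (x, 0) =
      ∑ i, pderiv i (velocity fun q => a q i) x := by
  have hc : ∀ i j, ContDiffOn ℝ ∞ (fun p => (if i = j then 1 else 0) +
      dirDeriv ((Pi.single j 1 : Coord n), (0 : ℝ)) (fun q => a q i) p) S := fun i _ =>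
    contDiffOn_const.add (contDiffOn_dirDeriv hS (contDiffOn_pi.1 ha i) _)
  have hM := ContDiffOn.differentiableAt_of_isOpen
    (contDiffOn_pi.2 fun i => contDiffOn_pi.2 fun j => hc i j) hS (h0 x hx)
  have hone : (fun i j => (if i = j then 1 else 0) +
      dirDeriv ((Pi.single j 1 : Coord n), (0 : ℝ)) (fun q => a q i) (x, 0)) =
      fun i j => (if i = j then 1 else 0) := by
    funext i j
    rw [dirDeriv_space_eq_zero hU hS h0 (contDiffOn_pi.1 ha i)
      (fun y hy => congrFun (ha0 y hy) i) hx, add_zero]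
  have := dirDeriv_comp (h := fun A : Fin n → Fin n → ℝ => (Matrix.of A).det)
    (g := fun p i j => (if i = j then 1 else 0) +
      dirDeriv ((Pi.single j 1 : Coord n), (0 : ℝ)) (fun q => a q i) p) (x := (x, (0 : ℝ)))
    (contDiff_det.differentiable (by simp) _) hM ((0 : Coord n), (1 : ℝ))
  rw [hone] at this
  refine this.trans ?_
  rw [dirDeriv, fderiv_det_one]
  refine Finset.sum_congr rfl fun i _ => ?_
  have hci := fun j => ContDiffOn.differentiableAt_of_isOpen (hc i j) hS (h0 x hx)
  rw [dirDeriv_pi fun i => differentiableAt_pi.2 fun j =>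
    ContDiffOn.differentiableAt_of_isOpen (hc i j) hS (h0 x hx)]
  beta_reduce
  rw [dirDeriv_pi hci]
  beta_reduce
  rw [dirDeriv_add (differentiableAt_const _) (ContDiffOn.differentiableAt_of_isOpen
      (contDiffOn_dirDeriv hS (contDiffOn_pi.1 ha i) _) hS (h0 x hx)),
    dirDeriv_comm hS (contDiffOn_pi.1 ha i) _ _ (h0 x hx), pderiv_eq_dirDeriv,
    ← dirDeriv_slice hS (contDiffOn_dirDeriv hS (contDiffOn_pi.1 ha i) _) (h0 x hx)]
  simp only [dirDeriv, fderiv_fun_const, Pi.zero_apply, zero_apply, zero_add]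
  rfl

end

theorem det_fderiv_flow {S : Set (Coord n × ℝ)} (hS : IsOpen S) {a : Coord n × ℝ → Coord n}
    (ha : ContDiffOn ℝ ∞ a S) {x : Coord n} {t : ℝ} (hx : (x, t) ∈ S) :
    (fderiv ℝ (fun z => z + a (z, t)) x).det = flowJacobian a (x, t) := by
  have hd : DifferentiableAt ℝ (fun z => a (z, t)) x :=
    ContDiffOn.differentiableAt_of_isOpen (contDiffOn_slice ha t) (isOpen_slice hS t) hx
  rw [ContinuousLinearMap.det, ← LinearMap.det_toMatrix', flowJacobian]
  congr 1
  ext i j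
  rw [LinearMap.toMatrix'_apply, Matrix.of_apply,
    ← dirDeriv_slice hS (contDiffOn_pi.1 ha i) hx, ContinuousLinearMap.coe_coe,
    fderiv_fun_add differentiableAt_fun_id hd]
  have h1 : dirDeriv (Pi.single j 1) (fun z => a (z, t)) x i =
      dirDeriv (Pi.single j 1) (fun z => a (z, t) i) x := by
    rw [dirDeriv_pi (differentiableAt_pi.1 hd)]
  rw [← h1]
  simp [dirDeriv, Pi.single_apply]

end Flow

/-! ### The transformed fields and the first variation of the pulled-back density -/

section Transport

variable {𝕜 : Type*} [RCLike 𝕜] {n f N r : ℕ}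

theorem jet_congr {U : Set (Coord n)} (hU : IsOpen U) {Φ Φ' : Coord n → Fin f → 𝕜}
    (h : EqOn Φ Φ' U) : EqOn (jet N Φ) (jet N Φ') U := fun x hx => by
  funext i
  exact iterPderiv_congr hU (fun y hy => congrFun (h hy) i.1) i.2.2 hx

/-- The derivatives of order at most `N` of `G (·, t)` at `y`, as a function of `(y, t)`. -/
def spaceJet (N : ℕ) (G : Coord n × ℝ → Fin f → 𝕜) (q : Coord n × ℝ) : Jet 𝕜 n f N :=
  jet N (fun y => G (y, q.2)) q.1

theorem spaceJet_apply_eqOn {W : Set (Coord n × ℝ)} (hW : IsOpen W)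
    {G : Coord n × ℝ → Fin f → 𝕜} (hG : ContDiffOn ℝ ∞ G W) (i : JetIndex n f N) :
    EqOn (fun q => spaceJet N G q i)
      (listDeriv ((coordDirs (List.ofFn i.2.2)).map fun v => (v, (0 : ℝ))) fun q => G q i.1) W := by
  rintro ⟨y, t⟩ hq
  simp only [spaceJet, jet]
  rw [iterPderiv_eq_listDeriv]
  exact listDeriv_slice hW (contDiffOn_pi.1 hG i.1) t _ hq

theorem contDiffOn_spaceJet {W : Set (Coord n × ℝ)} (hW : IsOpen W)
    {G : Coord n × ℝ → Fin f → 𝕜} (hG : ContDiffOn ℝ ∞ G W) :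
    ContDiffOn ℝ ∞ (spaceJet N G) W :=
  contDiffOn_pi.2 fun i => (contDiffOn_listDeriv hW (contDiffOn_pi.1 hG i.1) _).congr
    (spaceJet_apply_eqOn hW hG i)

theorem velocity_spaceJet {W : Set (Coord n × ℝ)} (hW : IsOpen W)
    {G : Coord n × ℝ → Fin f → 𝕜} (hG : ContDiffOn ℝ ∞ G W) {x : Coord n}
    (hx : (x, (0 : ℝ)) ∈ W) :
    velocity (spaceJet N G) x = jet N (fun y B => velocity (fun q => G q B) y) x := by
  have hd := ContDiffOn.differentiableAt_of_isOpen (contDiffOn_spaceJet (N := N) hW hG) hW hx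
  rw [velocity, dirDeriv_pi (differentiableAt_pi.1 hd)]
  funext i
  have hGi := contDiffOn_pi.1 hG i.1
  rw [dirDeriv_congr hW (spaceJet_apply_eqOn hW hG i) _ hx, dirDeriv_listDeriv hW hGi _ _ hx,
    jet, iterPderiv_eq_listDeriv]
  exact (listDeriv_slice hW (contDiffOn_dirDeriv hW hGi _) 0 _ hx).symm

/-- The fields carried along by the flow `e`, with the increment `b`. -/
def transported (e : OpenPartialHomeomorph (Coord n × ℝ) (Coord n × ℝ))
    (Φ : Coord n → Fin f → 𝕜) (b : Coord n × ℝ → Fin f → 𝕜) (q : Coord n × ℝ) : Fin f → 𝕜 :=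
  Φ (e.symm q).1 + b (e.symm q)

/-- The integrand of the transformed action, pulled back to the original region. -/
def pulledBackDensity (L : Coord n × Jet 𝕜 n f N → 𝕜) (G : Coord n × ℝ → Fin f → 𝕜)
    (a : Coord n × ℝ → Coord n) (p : Coord n × ℝ) : 𝕜 :=
  (flowJacobian a p : 𝕜) * L ((flowMap a p).1, spaceJet N G (flowMap a p))

section

variable {U : Set (Coord n)} {S : Set (Coord n × ℝ)} (hU : IsOpen U)
  (hS : IsOpen S) (h0 : ∀ x ∈ U, (x, (0 : ℝ)) ∈ S) (hSU : ∀ p ∈ S, p.1 ∈ U)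
  {a : Coord n × ℝ → Coord n} (ha : ContDiffOn ℝ ∞ a S) (ha0 : ∀ x ∈ U, a (x, 0) = 0)
  {b : Coord n × ℝ → Fin f → 𝕜} (hb : ContDiffOn ℝ ∞ b S) (hb0 : ∀ x ∈ U, b (x, 0) = 0)
  {Φ : Coord n → Fin f → 𝕜} (hΦ : ContDiffOn ℝ ∞ Φ U)
  {e : OpenPartialHomeomorph (Coord n × ℝ) (Coord n × ℝ)} (heS : e.source ⊆ S)
  (hea : (e : Coord n × ℝ → Coord n × ℝ) = flowMap a) (hes : ContDiffOn ℝ ∞ e.symm e.target)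

include hSU hb hΦ heS hes in
theorem contDiffOn_transported : ContDiffOn ℝ ∞ (transported e Φ b) e.target :=
  (hΦ.comp hes.fst fun _ hq => hSU _ (heS (e.map_target hq))).add
    (hb.comp hes fun _ hq => heS (e.map_target hq))

include hea in
theorem transported_flowMap {p : Coord n × ℝ} (hp : p ∈ e.source) :
    transported e Φ b (flowMap a p) = Φ p.1 + b p := by
  rw [transported, ← hea, e.left_inv hp]

include hea hSU ha0 heS in
theorem mem_target_of_zero {x : Coord n} (hx : (x, (0 : ℝ)) ∈ e.source) :
    (x, (0 : ℝ)) ∈ e.target := by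
  have := e.map_source hx
  rwa [hea, flowMap_zero (ha0 x (hSU _ (heS hx)))] at this

include hea hSU ha0 hb0 heS in
theorem transported_zero {x : Coord n} (hx : (x, (0 : ℝ)) ∈ e.source) :
    transported e Φ b (x, 0) = Φ x := by
  have hxU : x ∈ U := hSU _ (heS hx)
  have := transported_flowMap (Φ := Φ) (b := b) hea hx
  rwa [flowMap_zero (ha0 x hxU), hb0 x hxU, add_zero] at this

include hea hSU ha0 hb0 heS in
theorem spaceJet_transported_zero {x : Coord n} (hx : (x, (0 : ℝ)) ∈ e.source) :
    spaceJet N (transported e Φ b) (x, 0) = jet N Φ x :=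
  jet_congr (isOpen_slice e.open_source 0)
    (fun _ hy => transported_zero hSU ha0 hb0 heS hea hy) hx

include hU hS h0 hSU ha ha0 hb hb0 hΦ heS hea hes

/-- Differentiate G(x + a(x, t), t) = Φ(x) + b(x, t) in t at 0, where G denotes the transported
fields: the left side gives ȧ^s ∂_s Φ + ∂_t G, the right side ∂_t b. -/
theorem velocity_transported {x : Coord n} (hx : (x, (0 : ℝ)) ∈ e.source) (B : Fin f) :
    velocity (fun q => transported e Φ b q B) x = velocity (fun q => b q B) x -
      ∑ s, ((velocity (fun q => a q s) x : ℝ) : 𝕜) * pderiv s (fun z => Φ z B) x := by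
  have hxU : x ∈ U := hSU _ (heS hx)
  have hxS := h0 x hxU
  have hxT := mem_target_of_zero hSU ha0 heS hea hx
  have hG := contDiffOn_pi.1 (contDiffOn_transported hSU hb hΦ heS hes) B
  have hda := ContDiffOn.differentiableAt_of_isOpen ha hS hxS
  have hdΦ := ContDiffOn.differentiableAt_of_isOpen (contDiffOn_component hΦ B) hU hxU
  have hdΦ' : DifferentiableAt ℝ (fun p : Coord n × ℝ => Φ p.1 B) (x, 0) :=
    DifferentiableAt.comp (g := fun z => Φ z B) (x, (0 : ℝ)) hdΦ differentiableAt_fst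
  have hfl := flowMap_zero (ha0 x hxU)
  have h1 : EqOn (fun p => transported e Φ b (flowMap a p) B) (fun p => Φ p.1 B + b p B)
      e.source := fun p hp => congrFun (transported_flowMap hea hp) B
  have h2 := dirDeriv_congr e.open_source h1 ((0 : Coord n), (1 : ℝ)) hx
  have hspace : EqOn (fun z => transported e Φ b (z, 0) B) (fun z => Φ z B)
      {z | (z, (0 : ℝ)) ∈ e.source} := fun z hz =>
    congrFun (transported_zero hSU ha0 hb0 heS hea hz) B
  have hsplit : (velocity a x, (1 : ℝ)) = (velocity a x, 0) + ((0 : Coord n), (1 : ℝ)) := by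
    simp
  -- The direction (ȧ, 1) splits into a spatial part, along which G restricts to Φ at t = 0, and a
  -- pure time part.
  rw [dirDeriv_comp (h := fun q => transported e Φ b q B)
      (hfl.symm ▸ ContDiffOn.differentiableAt_of_isOpen hG e.open_target hxT)
      (ContDiffOn.differentiableAt_of_isOpen (contDiffOn_flowMap ha) hS hxS), hfl,
    dirDeriv_flowMap_time hS h0 ha hxU, hsplit, dirDeriv_add_direction,
    ← dirDeriv_slice e.open_target hG hxT,
    dirDeriv_congr (isOpen_slice e.open_source 0) hspace _ hx, dirDeriv_coord,
    dirDeriv_add hdΦ'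
      (ContDiffOn.differentiableAt_of_isOpen (contDiffOn_pi.1 hb B) hS hxS),
    dirDeriv_comp (h := fun z => Φ z B) hdΦ differentiableAt_fst, dirDeriv_fst] at h2
  have h3 : dirDeriv (0 : Coord n) (fun z => Φ z B) x = 0 := map_zero _
  rw [h3, zero_add] at h2
  have h4 : ∀ s, velocity a x s = velocity (fun q => a q s) x := fun s => by
    rw [velocity, dirDeriv_pi (differentiableAt_pi.1 hda)]
    rfl
  simp only [h4, RCLike.real_smul_eq_coe_mul] at h2
  rw [eq_sub_iff_add_eq, add_comm]
  exact h2

variable {D : Set (Coord n × Jet 𝕜 n f N)} {L : Coord n × Jet 𝕜 n f N → 𝕜}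
  (hL : IsLagrangian D L) (hΦD : ∀ x ∈ U, (x, jet N Φ x) ∈ D)

include hL hΦD

theorem exists_isOpen_contDiffOn_pulledBackDensity {x : Coord n}
    (hx : (x, (0 : ℝ)) ∈ e.source) :
    ∃ T : Set (Coord n × ℝ), IsOpen T ∧ (x, (0 : ℝ)) ∈ T ∧ T ⊆ e.source ∧
      (∀ p ∈ T, 0 < flowJacobian a p) ∧
      ContDiffOn ℝ ∞ (pulledBackDensity L (transported e Φ b) a) T ∧
      velocity (pulledBackDensity L (transported e Φ b) a) x =
        fderiv ℝ L (x, jet N Φ x) (0, jet N (fun y B => velocity (fun q => b q B) y -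
          ∑ s, ((velocity (fun q => a q s) y : ℝ) : 𝕜) * pderiv s (fun z => Φ z B) y) x) +
        ∑ l : Fin n, pderiv l
          (fun y => ((velocity (fun q => a q l) y : ℝ) : 𝕜) * L (y, jet N Φ y)) x := by
  set G := transported e Φ b
  have hxU : x ∈ U := hSU _ (heS hx)
  have hxS := h0 x hxU
  have hxT := mem_target_of_zero hSU ha0 heS hea hx
  have hG : ContDiffOn ℝ ∞ G e.target := contDiffOn_transported hSU hb hΦ heS hes
  have hJ : ContDiffOn ℝ ∞ (fun q : Coord n × ℝ => (q.1, spaceJet N G q)) e.target :=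
    contDiffOn_fst.prodMk (contDiffOn_spaceJet e.open_target hG)
  let W := e.target ∩ (fun q : Coord n × ℝ => (q.1, spaceJet N G q)) ⁻¹' D
  -- `W` is where the jet of the transported fields stays in the domain of L.
  have hW : IsOpen W := hJ.continuousOn.isOpen_inter_preimage e.open_target hL.isOpen
  have hLW : ContDiffOn ℝ ∞ (fun q : Coord n × ℝ => L (q.1, spaceJet N G q)) W :=
    hL.contDiffOn.comp (hJ.mono inter_subset_left) fun q hq => hq.2
  have hzero : ∀ y, (y, (0 : ℝ)) ∈ e.source → spaceJet N G (y, 0) = jet N Φ y := fun y hy =>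
    spaceJet_transported_zero hSU ha0 hb0 heS hea hy
  have hxW : (x, (0 : ℝ)) ∈ W := ⟨hxT, by
    rw [mem_preimage, hzero x hx]
    exact hΦD x hxU⟩
  have hfm : ContDiffOn ℝ ∞ (flowMap a) e.source := (contDiffOn_flowMap ha).mono heS
  have hjac : ContDiffOn ℝ ∞ (flowJacobian a) e.source := (contDiffOn_flowJacobian hS ha).mono heS
  have hfl := flowMap_zero (ha0 x hxU)
  -- A positive Jacobian is imposed so that the absolute value in the change of variables can be
  -- dropped.
  let T := (e.source ∩ flowMap a ⁻¹' W) ∩ (e.source ∩ flowJacobian a ⁻¹' Ioi 0)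
  have hT : IsOpen T := (hfm.continuousOn.isOpen_inter_preimage e.open_source hW).inter
    (hjac.continuousOn.isOpen_inter_preimage e.open_source isOpen_Ioi)
  have hj1 : flowJacobian a (x, 0) = 1 := flowJacobian_zero hU hS h0 ha ha0 hxU
  have hxTT : (x, (0 : ℝ)) ∈ T := ⟨⟨hx, by rw [mem_preimage, hfl]; exact hxW⟩, hx, by
    simp [hj1]⟩
  have hjacT := hjac.mono (fun p (hp : p ∈ T) => hp.1.1)
  have hcomp : ContDiffOn ℝ ∞ (fun p => L ((flowMap a p).1, spaceJet N G (flowMap a p))) T :=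
    hLW.comp (hfm.mono fun p hp => hp.1.1) fun p hp => hp.1.2
  refine ⟨T, hT, hxTT, fun p hp => hp.1.1, fun p hp => hp.2.2,
    (contDiffOn_ofReal hjacT).mul hcomp, ?_⟩
  have hda := ContDiffOn.differentiableAt_of_isOpen ha hS hxS
  have hdj := ContDiffOn.differentiableAt_of_isOpen hjacT hT hxTT
  have hdL := ContDiffOn.differentiableAt_of_isOpen hLW hW hxW
  have hdJ := ContDiffOn.differentiableAt_of_isOpen hJ e.open_target hxT
  have hLU := contDiffOn_lagrangian_jet hL hU hΦ hΦD
  have hdLU := ContDiffOn.differentiableAt_of_isOpen hLU hU hxU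
  have hva : ∀ s, ContDiffOn ℝ ∞ (velocity fun q => a q s) U := fun s =>
    (contDiffOn_slice (contDiffOn_dirDeriv hS (contDiffOn_pi.1 ha s) _) 0).mono h0
  have hdva := fun s => ContDiffOn.differentiableAt_of_isOpen (hva s) hU hxU
  have hspace : EqOn (fun z => L (z, spaceJet N G (z, 0))) (fun z => L (z, jet N Φ z))
      {z | (z, (0 : ℝ)) ∈ e.source} := fun z hz => by
    simp only [hzero z hz]
  -- The identity is needed on a whole open slice, since jets are taken of both sides.
  have hη : EqOn (fun y B => velocity (fun q => G q B) y)
      (fun y B => velocity (fun q => b q B) y -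
        ∑ s, ((velocity (fun q => a q s) y : ℝ) : 𝕜) * pderiv s (fun z => Φ z B) y)
      {z | (z, (0 : ℝ)) ∈ e.source} := fun z hz => by
    funext B
    exact velocity_transported hU hS h0 hSU ha ha0 hb hb0 hΦ heS hea hes hz B
  have hvL : dirDeriv ((0 : Coord n), (1 : ℝ))
      (fun q : Coord n × ℝ => L (q.1, spaceJet N G q)) (x, 0) =
      fderiv ℝ L (x, jet N Φ x) (0, jet N (fun y B => velocity (fun q => b q B) y -
          ∑ s, ((velocity (fun q => a q s) y : ℝ) : 𝕜) * pderiv s (fun z => Φ z B) y) x) := by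
    have hdL' : DifferentiableAt ℝ L (x, spaceJet N G (x, 0)) :=
      ContDiffOn.differentiableAt_of_isOpen hL.contDiffOn hL.isOpen hxW.2
    rw [dirDeriv_comp (h := L) (g := fun q : Coord n × ℝ => (q.1, spaceJet N G q)) hdL' hdJ,
      dirDeriv_prodMk differentiableAt_fst (ContDiffOn.differentiableAt_of_isOpen
        (contDiffOn_spaceJet e.open_target hG) e.open_target hxT), dirDeriv_fst,
      ← jet_congr (isOpen_slice e.open_source 0) hη hx, ← velocity_spaceJet e.open_target hG hxT,
      ← hzero x hx]
    rfl
  have hsplit : (velocity a x, (1 : ℝ)) = (velocity a x, 0) + ((0 : Coord n), (1 : ℝ)) := by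
    simp
  have hvc : dirDeriv ((0 : Coord n), (1 : ℝ))
      (fun p => L ((flowMap a p).1, spaceJet N G (flowMap a p))) (x, 0) =
      ∑ s, velocity a x s • dirDeriv (Pi.single s 1) (fun z => L (z, jet N Φ z)) x +
        dirDeriv ((0 : Coord n), (1 : ℝ))
          (fun q : Coord n × ℝ => L (q.1, spaceJet N G q)) (x, 0) := by
    rw [dirDeriv_comp (h := fun q : Coord n × ℝ => L (q.1, spaceJet N G q)) (hfl.symm ▸ hdL)
        (ContDiffOn.differentiableAt_of_isOpen (contDiffOn_flowMap ha) hS hxS), hfl,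
      dirDeriv_flowMap_time hS h0 ha hxU, hsplit, dirDeriv_add_direction,
      ← dirDeriv_slice hW hLW hxW,
      dirDeriv_congr (isOpen_slice e.open_source 0) hspace _ hx, dirDeriv_coord]
  have h4 : ∀ s, velocity a x s = velocity (fun q => a q s) x := fun s => by
    rw [velocity, dirDeriv_pi (differentiableAt_pi.1 hda)]
    rfl
  have hI : pulledBackDensity L G a = fun p =>
      (flowJacobian a p : 𝕜) * L ((flowMap a p).1, spaceJet N G (flowMap a p)) := rfl
  rw [velocity, hI, dirDeriv_mul (differentiableAt_ofReal hdj)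
    (ContDiffOn.differentiableAt_of_isOpen hcomp hT hxTT), dirDeriv_ofReal hdj, hvc, hvL,
    dirDeriv_flowJacobian hU hS h0 ha ha0 hxU, hj1, hfl, hzero x hx]
  -- The product rule for ∂_l(ξ^l L) matches the Jacobian term and the displacement term.
  have h5 : ∀ l, pderiv l (fun y => ((velocity (fun q => a q l) y : ℝ) : 𝕜) * L (y, jet N Φ y)) x =
      ((pderiv l (velocity fun q => a q l) x : ℝ) : 𝕜) * L (x, jet N Φ x) +
        ((velocity (fun q => a q l) x : ℝ) : 𝕜) * pderiv l (fun y => L (y, jet N Φ y)) x := fun l => by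
    rw [pderiv_eq_dirDeriv, dirDeriv_mul
      (differentiableAt_ofReal (hdva l)) hdLU, dirDeriv_ofReal (hdva l)]
    rfl
  simp only [h5, Finset.sum_add_distrib, ← Finset.sum_mul, h4, RCLike.real_smul_eq_coe_mul,
    RCLike.ofReal_sum, RCLike.ofReal_one, pderiv_eq_dirDeriv]
  ring

end

end Transport

/-! ### From invariance of the action to a pointwise identity -/

section Invariance

variable {𝕜 : Type*} [RCLike 𝕜] {n f N r : ℕ}

/-- Restriction of a family with parameters `ε` to the line `ε = t v`. -/
def alongLine {G : Type*} (H : Coord n → (Fin r → ℝ) → G) (v : Fin r → ℝ) (p : Coord n × ℝ) : G :=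
  H p.1 (p.2 • v)

/-- The domain of `alongLine`. -/
def lineDomain (U : Set (Coord n)) (V : Set (Fin r → ℝ)) (v : Fin r → ℝ) : Set (Coord n × ℝ) :=
  {p | p.1 ∈ U ∧ p.2 • v ∈ V}

theorem contDiff_line (v : Fin r → ℝ) :
    ContDiff ℝ ∞ fun p : Coord n × ℝ => (p.1, p.2 • v) :=
  contDiff_fst.prodMk (contDiff_snd.smul contDiff_const)

theorem isOpen_lineDomain {U : Set (Coord n)} (hU : IsOpen U) {V : Set (Fin r → ℝ)}
    (hV : IsOpen V) (v : Fin r → ℝ) : IsOpen (lineDomain U V v) :=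
  (hU.prod hV).preimage (contDiff_line v).continuous

theorem contDiffOn_alongLine {G : Type*} [NormedAddCommGroup G] [NormedSpace ℝ G]
    {U : Set (Coord n)} {V : Set (Fin r → ℝ)} {H : Coord n → (Fin r → ℝ) → G}
    (hH : ContDiffOn ℝ ∞ (fun p : Coord n × (Fin r → ℝ) => H p.1 p.2) (U ×ˢ V))
    (v : Fin r → ℝ) : ContDiffOn ℝ ∞ (alongLine H v) (lineDomain U V v) :=
  hH.comp (contDiff_line v).contDiffOn fun _ hp => hp

theorem velocity_alongLine {G : Type*} [NormedAddCommGroup G] [NormedSpace ℝ G]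
    {U : Set (Coord n)} (hU : IsOpen U) {V : Set (Fin r → ℝ)} (hV : IsOpen V)
    (hV0 : (0 : Fin r → ℝ) ∈ V) {H : Coord n → (Fin r → ℝ) → G}
    (hH : ContDiffOn ℝ ∞ (fun p : Coord n × (Fin r → ℝ) => H p.1 p.2) (U ×ˢ V))
    (v : Fin r → ℝ) {y : Coord n} (hy : y ∈ U) :
    velocity (alongLine H v) y = fderiv ℝ (fun ε => H y ε) 0 v := by
  have hg : DifferentiableAt ℝ (fun p : Coord n × ℝ => (p.1, p.2 • v)) (y, 0) :=
    (contDiff_line v).differentiable (by simp) _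
  have hH' : DifferentiableAt ℝ (fun p : Coord n × (Fin r → ℝ) => H p.1 p.2)
      ((fun p : Coord n × ℝ => (p.1, p.2 • v)) (y, 0)) :=
    ContDiffOn.differentiableAt_of_isOpen hH (hU.prod hV) ⟨hy, by simpa using hV0⟩
  have hline : dirDeriv ((0 : Coord n), (1 : ℝ)) (fun p : Coord n × ℝ => p.2 • v) (y, 0) = v := by
    have : HasFDerivAt (fun p : Coord n × ℝ => p.2 • v)
        ((ContinuousLinearMap.snd ℝ (Coord n) ℝ).smulRight v) (y, 0) :=
      ((ContinuousLinearMap.snd ℝ (Coord n) ℝ).smulRight v).hasFDerivAt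
    rw [dirDeriv, this.fderiv]
    simp
  have h1 := dirDeriv_comp (h := fun p : Coord n × (Fin r → ℝ) => H p.1 p.2)
    (g := fun p : Coord n × ℝ => (p.1, p.2 • v)) hH' hg ((0 : Coord n), (1 : ℝ))
  rw [dirDeriv_prodMk differentiableAt_fst (differentiableAt_snd.fun_smul
    (differentiableAt_const v)), dirDeriv_fst, hline] at h1
  refine Eq.trans h1 ?_
  simp only [zero_smul]
  exact (fderiv_param_eq (hU.prod hV) hH ⟨hy, hV0⟩ v).symm

/-- Change of variables along x ↦ x + δx. On the image of Ω the inverse chosen by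
`Function.invFunOn` agrees with the slice of `e.symm`, because injectivity of `e` makes the preimage
in Ω unique. -/
theorem action_transformedField (L : Coord n × Jet 𝕜 n f N → 𝕜) (Φ : Coord n → Fin f → 𝕜)
    (δx : Coord n → (Fin r → ℝ) → Coord n) (δΦ : Coord n → (Fin r → ℝ) → Fin f → 𝕜)
    (v : Fin r → ℝ) {S : Set (Coord n × ℝ)} (hS : IsOpen S)
    (ha : ContDiffOn ℝ ∞ (alongLine δx v) S)
    {e : OpenPartialHomeomorph (Coord n × ℝ) (Coord n × ℝ)} (heS : e.source ⊆ S)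
    (hea : (e : Coord n × ℝ → Coord n × ℝ) = flowMap (alongLine δx v)) {Ω : Set (Coord n)}
    (hΩ : IsOpen Ω) {t : ℝ} (hsub : ∀ y ∈ Ω, (y, t) ∈ e.source)
    (hpos : ∀ y ∈ Ω, 0 < flowJacobian (alongLine δx v) (y, t)) :
    action L (transformedField Φ δx δΦ Ω (t • v)) (coordMap δx (t • v) '' Ω) =
      ∫ y in Ω, pulledBackDensity L (transported e Φ (alongLine δΦ v)) (alongLine δx v) (y, t) := by
  have hcm : ∀ y, flowMap (alongLine δx v) (y, t) = (coordMap δx (t • v) y, t) := fun y => rfl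
  have hinj : InjOn (coordMap δx (t • v)) Ω := fun y hy z hz h => by
    have h' : e (y, t) = e (z, t) := by rw [hea, hcm, hcm, h]
    exact congrArg Prod.fst (e.injOn (hsub y hy) (hsub z hz) h')
  have hderiv : ∀ y ∈ Ω, HasFDerivWithinAt (coordMap δx (t • v))
      (fderiv ℝ (fun z => z + alongLine δx v (z, t)) y) Ω y := fun y hy =>
    (differentiableAt_fun_id.fun_add (ContDiffOn.differentiableAt_of_isOpen
      (contDiffOn_slice ha t) (isOpen_slice hS t)
        (heS (hsub y hy)))).hasFDerivAt.hasFDerivWithinAt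
  -- Equal fields have equal jets only on an open set. The image is the t-slice of the open image
  -- under `e` of a cylinder over Ω, since `e` preserves t.
  have hopen : IsOpen (coordMap δx (t • v) '' Ω) := by
    have h1 : IsOpen (e '' (e.source ∩ Prod.fst ⁻¹' Ω)) :=
      e.isOpen_image_of_subset_source (e.open_source.inter (hΩ.preimage continuous_fst))
        inter_subset_left
    convert! isOpen_slice h1 t using 1
    ext y
    simp only [mem_image, mem_ofPred_eq, hea]
    constructor
    · rintro ⟨z, hz, rfl⟩
      exact ⟨(z, t), ⟨hsub z hz, hz⟩, rfl⟩
    · rintro ⟨⟨z, s⟩, ⟨-, hz⟩, h⟩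
      obtain rfl : s = t := congrArg Prod.snd h
      exact ⟨z, hz, congrArg Prod.fst h⟩
  have hfield : EqOn (transformedField Φ δx δΦ Ω (t • v))
      (fun y => transported e Φ (alongLine δΦ v) (y, t)) (coordMap δx (t • v) '' Ω) := by
    rintro _ ⟨z, hz, rfl⟩
    beta_reduce
    rw [← hcm, transported_flowMap hea (hsub z hz), transformedField, hinj.leftInvOn_invFunOn hz]
    rfl
  rw [action, integral_image_eq_integral_abs_det_fderiv_smul volume hΩ.measurableSet hderiv hinj]
  refine setIntegral_congr_fun hΩ.measurableSet fun y hy => ?_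
  rw [det_fderiv_flow hS ha (heS (hsub y hy)), abs_of_pos (hpos y hy),
    jet_congr hopen hfield (mem_image_of_mem _ hy), RCLike.real_smul_eq_coe_mul]
  rfl

theorem variation_eq_zero_of_actionInvariant {U : Set (Coord n)} (hU : IsOpen U)
    {D : Set (Coord n × Jet 𝕜 n f N)} {L : Coord n × Jet 𝕜 n f N → 𝕜} (hL : IsLagrangian D L)
    {Φ : Coord n → Fin f → 𝕜} (hΦ : ContDiffOn ℝ ∞ Φ U) (hΦD : ∀ x ∈ U, (x, jet N Φ x) ∈ D)
    {V : Set (Fin r → ℝ)} (hV : IsOpen V) (hV0 : (0 : Fin r → ℝ) ∈ V)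
    {δx : Coord n → (Fin r → ℝ) → Coord n}
    (hδx : ContDiffOn ℝ ∞ (fun p : Coord n × (Fin r → ℝ) => δx p.1 p.2) (U ×ˢ V))
    (hδx0 : ∀ x ∈ U, δx x 0 = 0) {δΦ : Coord n → (Fin r → ℝ) → Fin f → 𝕜}
    (hδΦ : ContDiffOn ℝ ∞ (fun p : Coord n × (Fin r → ℝ) => δΦ p.1 p.2) (U ×ˢ V))
    (hδΦ0 : ∀ x ∈ U, δΦ x 0 = 0) (hinv : ActionInvariant U L Φ δx δΦ) (α : Fin r) {x : Coord n}
    (hx : x ∈ U) :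
    fderiv ℝ L (x, jet N Φ x) (0, jet N (fixedPointVariation Φ δx δΦ α) x) +
      ∑ l : Fin n, pderiv l (fun y => (coordGenerator δx α l y : 𝕜) * L (y, jet N Φ y)) x = 0 := by
  set v : Fin r → ℝ := Pi.single α 1
  have hS := isOpen_lineDomain hU hV v
  have h0 : ∀ y ∈ U, (y, (0 : ℝ)) ∈ lineDomain U V v := fun y hy => ⟨hy, by simpa using hV0⟩
  have ha := contDiffOn_alongLine hδx v
  have hb := contDiffOn_alongLine hδΦ v
  have ha0 : ∀ y ∈ U, alongLine δx v (y, 0) = 0 := fun y hy => by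
    simpa [alongLine] using hδx0 y hy
  have hb0 : ∀ y ∈ U, alongLine δΦ v (y, 0) = 0 := fun y hy => by
    simpa [alongLine] using hδΦ0 y hy
  obtain ⟨e, hxe, heS, hea, hes⟩ := exists_flow_openPartialHomeomorph hU hS h0 ha ha0 hx
  obtain ⟨T, hT, hxT, hTe, hpos, hI, hvel⟩ := exists_isOpen_contDiffOn_pulledBackDensity hU hS h0
    (fun p hp => hp.1) ha ha0 hb hb0 hΦ heS hea hes hL hΦD hxe
  set I := pulledBackDensity L (transported e Φ (alongLine δΦ v)) (alongLine δx v)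
  have hξ : ∀ s, EqOn (velocity fun q => alongLine δx v q s) (coordGenerator δx α s) U :=
    fun s y hy => velocity_alongLine (H := fun y ε => δx y ε s) hU hV hV0
      (contDiffOn_pi.1 hδx s) v hy
  have hφ : ∀ B, EqOn (velocity fun q => alongLine δΦ v q B) (fieldGenerator δΦ α B) U :=
    fun B y hy => velocity_alongLine (H := fun y ε => δΦ y ε B) hU hV hV0
      (contDiffOn_pi.1 hδΦ B) v hy
  have hη : EqOn (fun y B => velocity (fun q => alongLine δΦ v q B) y -
      ∑ s, ((velocity (fun q => alongLine δx v q s) y : ℝ) : 𝕜) * pderiv s (fun z => Φ z B) y)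
      (fixedPointVariation Φ δx δΦ α) U := fun y hy => by
    funext B
    beta_reduce
    rw [fixedPointVariation, hφ B hy]
    congr 1
    exact Finset.sum_congr rfl fun s _ => by rw [hξ s hy]
  have hdiv : ∀ l, pderiv l (fun y => ((velocity (fun q => alongLine δx v q l) y : ℝ) : 𝕜) *
      L (y, jet N Φ y)) x =
      pderiv l (fun y => (coordGenerator δx α l y : 𝕜) * L (y, jet N Φ y)) x := fun l =>
    dirDeriv_congr hU (fun y hy => by rw [hξ l hy]) _ hx
  rw [jet_congr hU hη hx] at hvel
  simp only [hdiv] at hvel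
  rw [← hvel]
  -- A box around (x, 0) on which one time interval serves all the balls at once.
  obtain ⟨A, hA, B, hB, hAB⟩ := mem_nhds_prod_iff.1 (Filter.inter_mem (hT.mem_nhds hxT)
    (hS.mem_nhds (h0 x hx)))
  obtain ⟨R, hR, hRA⟩ := Metric.nhds_basis_closedBall.mem_iff.1 hA
  obtain ⟨δ, hδ, hδB⟩ := Metric.nhds_basis_closedBall.mem_iff.1 hB
  have hsub := (prod_mono hRA hδB).trans hAB
  have hδ0 : (0 : ℝ) ∈ Metric.closedBall (0 : ℝ) δ := Metric.mem_closedBall_self hδ.le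
  refine dirDeriv_eq_zero_of_integral_isLittleO hT hI hR hδ
    (hsub.trans inter_subset_left) fun ρ hρ hρR => ?_
  have hball : Metric.ball x ρ ⊆ Metric.closedBall x R :=
    Metric.ball_subset_closedBall.trans (Metric.closedBall_subset_closedBall hρR)
  have hact : ∀ t ∈ Metric.closedBall (0 : ℝ) δ,
      action L (transformedField Φ δx δΦ (Metric.ball x ρ) (t • v))
        (coordMap δx (t • v) '' Metric.ball x ρ) = ∫ y in Metric.ball x ρ, I (y, t) := fun t ht =>
    action_transformedField L Φ δx δΦ v hS ha heS hea Metric.isOpen_ball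
      (fun y hy => hTe (hsub (a := (y, t)) ⟨hball hy, ht⟩).1)
      fun y hy => hpos _ (hsub (a := (y, t)) ⟨hball hy, ht⟩).1
  -- The reference term in the invariance condition is the action of Φ itself, so t = 0 is matched
  -- separately, with Jacobian 1 and the jet of Φ.
  have hact0 : action L Φ (Metric.ball x ρ) = ∫ y in Metric.ball x ρ, I (y, 0) := by
    refine setIntegral_congr_fun measurableSet_ball fun y hy => ?_
    have hyT := (hsub (a := (y, (0 : ℝ))) ⟨hball hy, hδ0⟩)
    have hyU : y ∈ U := hyT.2.1
    simp only [I, pulledBackDensity]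
    rw [flowMap_zero (ha0 y hyU), flowJacobian_zero hU hS h0 ha ha0 hyU,
      spaceJet_transported_zero (fun p hp => hp.1) ha0 hb0 heS hea (hTe hyT.1),
      RCLike.ofReal_one, one_mul]
  have hcl : closure (Metric.ball x ρ) ⊆ Metric.closedBall x R :=
    closure_minimal hball Metric.isClosed_closedBall
  have ho := hinv (Metric.ball x ρ) Metric.isOpen_ball
    ((isCompact_closedBall x R).of_isClosed_subset isClosed_closure hcl) fun y hy =>
      (hsub (a := (y, (0 : ℝ))) ⟨hcl hy, hδ0⟩).2.1
  have hline : Filter.Tendsto (fun t : ℝ => t • v) (𝓝 0) (𝓝 0) := by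
    have : Continuous fun t : ℝ => t • v := by fun_prop
    simpa using this.tendsto 0
  have hO : (fun t : ℝ => t • v) =O[𝓝 0] fun t : ℝ => t :=
    IsBigO.of_bound ‖v‖ (Filter.Eventually.of_forall fun t => by
      rw [norm_smul, mul_comm])
  -- Along ε = t v, an o(|ε|) is an o(t).
  refine ((ho.comp_tendsto hline).trans_isBigO hO).congr' ?_ Filter.EventuallyEq.rfl
  filter_upwards [Metric.closedBall_mem_nhds (0 : ℝ) hδ] with t ht
  simp only [Function.comp_apply]
  rw [hact t ht, hact0]

end Invariance

end FieldTheory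

end

/-! ### Noether's theorem -/

open FieldTheory in
theorem mainTheorem1 {𝕜 : Type*} [RCLike 𝕜] (n f N r : ℕ) (hn : 2 ≤ n) (hN : 1 ≤ N)
    (U : Set (Coord n)) (hU : IsOpen U)
    (D : Set (Coord n × Jet 𝕜 n f N)) (L : Coord n × Jet 𝕜 n f N → 𝕜) (hL : IsLagrangian D L)
    (Φ : Coord n → Fin f → 𝕜) (hΦ : ContDiffOn ℝ ∞ Φ U) (hΦD : ∀ x ∈ U, (x, jet N Φ x) ∈ D)
    (V : Set (Fin r → ℝ)) (hV : IsOpen V) (hV0 : (0 : Fin r → ℝ) ∈ V)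
    (δx : Coord n → (Fin r → ℝ) → Coord n)
    (hδx : ContDiffOn ℝ ∞ (fun p : Coord n × (Fin r → ℝ) => δx p.1 p.2) (U ×ˢ V))
    (hδx0 : ∀ x ∈ U, δx x 0 = 0)
    (δΦ : Coord n → (Fin r → ℝ) → Fin f → 𝕜)
    (hδΦ : ContDiffOn ℝ ∞ (fun p : Coord n × (Fin r → ℝ) => δΦ p.1 p.2) (U ×ˢ V))
    (hδΦ0 : ∀ x ∈ U, δΦ x 0 = 0)
    (hinv : ActionInvariant U L Φ δx δΦ)
    (hEL : ∀ B : Fin f, ∀ x ∈ U, eulerLagrange L Φ B x = 0) :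
    ∀ α : Fin r,
      (∀ l : Fin n, ContDiffOn ℝ ∞ (noetherCurrent L Φ δx δΦ α l) U) ∧
        ∀ x ∈ U, ∑ l : Fin n, pderiv l (noetherCurrent L Φ δx δΦ α l) x = 0 := fun α =>
  ⟨contDiffOn_noetherCurrent hU hL hΦ hΦD hV hV0 hδx hδΦ α, fun _ hx =>
    (divergence_noetherCurrent hU hL hΦ hΦD hV hV0 hδx hδΦ hEL α hx).trans
      (variation_eq_zero_of_actionInvariant hU hL hΦ hΦD hV hV0 hδx hδx0 hδΦ hδΦ0 hinv α hx)⟩
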